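/- **Setting.** Let $K\ge 2$ be an even integer, $N_{\mathrm n},N_{\mathrm f}\ge 1$ integers, and $\Omega_{\mathrm n},\Omega_{\mathrm f},\Omega_{\mathrm p},I,B,T,\theta,\mathscr N_0>0$ and $\delta\in(0,1)$ real numbers. A transmitter serves a pair of users, $\mathrm U_{\mathrm n}$ (near) and $\mathrm U_{\mathrm f}$ (far), having $N_{\mathrm n}$ and $N_{\mathrm f}$ antennas, over independent Rayleigh channels $h_{u,i}=\sqrt{\Omega_u}\,\hat h_{u,i}$, $u\in\{\mathrm n,\mathrm f\}$, $1\le i\le N_u$, with $\hat h_{u,i}\sim\mathcal{CN}(0,1)$ independent. Let $g_u=\sum_{i=1}^{N_u}|h_{u,i}|^2$. The power allocation coefficients satisfy $0<a_{\mathrm s}<a_{\mathrm w}$ and $a_{\mathrm s}+a_{\mathrm w}=2/K$. Put $\mathcal B=2B/K$, $P_{\mathrm t}^*=-I/(\Omega_{\mathrm p}\ln\delta)$, $\hat P_{\mathrm t}^*=P_{\mathrm t}^*/(\mathscr N_0\mathcal B)$, $\Omega=\Omega_{\mathrm n}\Omega_{\mathrm f}/(\Omega_{\mathrm n}+\Omega_{\mathrm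 f})$ and $\nu=\theta T\mathcal B/\ln 2$; assume that $\nu$ is not an integer. The effective rate belonging to a random SINR $\gamma$ is $-\frac1\nu\log_2\mathbb E[(1+\gamma)^{-\nu}]$. The transmit power is the constant $P_{\mathrm t}^*$, so that a receiver with channel gain $g$ sees the weak user's symbol with SINR $\gamma(g)=a_{\mathrm w}\hat P_{\mathrm t}^*g/(1+a_{\mathrm s}\hat P_{\mathrm t}^*g)$. * Case S–I: the weak user is the one with the smaller gain, and $\gamma_{\mathrm w}=\gamma(g_{\mathrm w})$ with $g_{\mathrm w}=\min\{g_{\mathrm n},g_{\mathrm f}\}$. * Case S–S: the weak user is fixed to be $\mathrm U_{\mathrm f}$, and, since its symbol has to be decoded at both users, $\gamma_{\mathrm w}=\min\{\gamma(g_{\mathrm n}),\gamma(g_{\mathrm f})\}$. **Special function.** For real $\alpha\geq 1$ and $x,y>0$, the extended generalized bivariate Meijer G-function below is the absolutely convergent iterated Mellin–Barnes integral $$\mathcal G_{1,1:1,1:0,1}^{1,1:1,1:1,0}\left(\begin{smallmatrix}1-\alpha\\ \nu-\alpha\end{smallmatrix}\middle|\begin{smallmatrix}1+\nu\\0\end{smallmatrix}\middle|\begin{smallmatrix}-\\0\end{smallmatrix}\middle|x,y\right)=\frac1{2\pi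 i}\int_{L}\Gamma(s)\Gamma(-\nu-s)x^{-s}\left[\frac1{2\pi i}\int_{L_s}\Gamma(\nu-\alpha+s+t)\Gamma(\alpha-s-t)\Gamma(t)\,y^{-t}\,dt\right]ds .$$ The contours run from $-i\infty$ to $+i\infty$. For each $s\in L$, the contour $L_s$ has the poles (in $t$) of $\Gamma(t)$ and $\Gamma(\nu-\alpha+s+t)$ on its left and those of $\Gamma(\alpha-s-t)$ on its right. The contour $L$ has the poles of $\Gamma(s)$ on its left, and the poles of $\Gamma(-\nu-s)$ and the points $\alpha,\alpha+1,\dots$ (the poles of the inner integral) on its right. **Claim.** For the values $\alpha=\alpha_1+\tau$ and the arguments occurring below, the integrals defining $\mathcal G$ converge absolutely. With $$T_6(\alpha_1,\alpha_2,\beta_1,\beta_2)=\sum_{\tau=0}^{\alpha_2-1}\frac{(2\hat P_{\mathrm t}^*/K)^{-(\alpha_1+\tau)}}{\Gamma(\alpha_1)\Gamma(\nu)\Gamma(-\nu)\beta_1^{\alpha_1}\beta_2^{\tau}\,\tau!}\;\mathcal G_{1,1:1,1:0,1}^{1,1:1,1:1,0}\left(\begin{smallmatrix}1-(\alpha_1+\tau)\\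 \nu-(\alpha_1+\tau)\end{smallmatrix}\middle|\begin{smallmatrix}1+\nu\\0\end{smallmatrix}\middle|\begin{smallmatrix}-\\0\end{smallmatrix}\middle|\tfrac K2a_{\mathrm s},\tfrac{K}{2\Omega\hat P_{\mathrm t}^*}\right),$$ the number $T_6(N_{\mathrm n},N_{\mathrm f},\Omega_{\mathrm n},\Omega_{\mathrm f})+T_6(N_{\mathrm f},N_{\mathrm n},\Omega_{\mathrm f},\Omega_{\mathrm n})$ is real and positive, and both in Case S–I and in Case S–S the effective rate of the weak user is $$R_{\mathrm w}=-\frac1\nu\log_2\left[T_6(N_{\mathrm n},N_{\mathrm f},\Omega_{\mathrm n},\Omega_{\mathrm f})+T_6(N_{\mathrm f},N_{\mathrm n},\Omega_{\mathrm f},\Omega_{\mathrm n})\right].$$ -/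

import Mathlib

open MeasureTheory ProbabilityTheory

noncomputable section

/-! ### The extended generalized bivariate Meijer G-function

The function is the Mellin-Barnes integral
`(2πi)⁻² ∫∫ Γ₁(s + t) Γ₂(s) Γ₃(t) x⁻ˢ y⁻ᵗ dt ds`,
where each `Γⱼ` is a quotient of products of Gamma functions with the parameters of one block, and
each contour runs from `-i∞` to `+i∞`, having on its left the poles of the Gamma factors in which
the variable has coefficient `+1` and on its right those of the Gamma factors in which it has
coefficient `-1`.  The inner contour (variable `t`) may depend on the outer variable `s`. -/

/-- The parameters of one block `G^{m,n}_{p,q}`: `aNum = (a₁,…,aₙ)`, `aDen = (aₙ₊₁,…,a_p)`,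
`bNum = (b₁,…,b_m)`, `bDen = (b_{m+1},…,b_q)`. -/
structure GammaBlock where
  aNum : List ℂ
  aDen : List ℂ
  bNum : List ℂ
  bDen : List ℂ

/-- The kernel
`∏_{j≤m} Γ(bⱼ + u) ∏_{j≤n} Γ(1 - aⱼ - u) / (∏_{j>n} Γ(aⱼ + u) ∏_{j>m} Γ(1 - bⱼ - u))`. -/
def GammaBlock.kernel (G : GammaBlock) (u : ℂ) : ℂ :=
  ((G.bNum.map fun b => Complex.Gamma (b + u)).prod *
      (G.aNum.map fun a => Complex.Gamma (1 - a - u)).prod) /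
    ((G.aDen.map fun a => Complex.Gamma (a + u)).prod *
      (G.bDen.map fun b => Complex.Gamma (1 - b - u)).prod)

/-- The union of the sequences `h, h - 1, h - 2, …` with `h` in the list. -/
def leftPoles (hs : List ℂ) : Set ℂ := {p | ∃ h ∈ hs, ∃ k : ℕ, p = h - k}

/-- The union of the sequences `h, h + 1, h + 2, …` with `h` in the list. -/
def rightPoles (hs : List ℂ) : Set ℂ := {p | ∃ h ∈ hs, ∃ k : ℕ, p = h + k}

/-- An abscissa to the right of all points of `A` (a set bounded to the right), such that no point
of `B` lies on the vertical line through it, nor strictly between that line and the rightmost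
abscissa of `A`.  If a vertical line separates `A` from `B`, the line through this abscissa does. -/
def sepAbscissa (A B : Set ℂ) : ℝ :=
  (sSup (Complex.re '' A) +
    sInf (insert (sSup (Complex.re '' A) + 2)
      {x | sSup (Complex.re '' A) < x ∧ ∃ q ∈ B, q.re = x})) / 2

/-- The points of `B` lying to the left of the vertical line through `sepAbscissa A B`. -/
def misplaced (A B : Set ℂ) : Set ℂ := {p | p ∈ B ∧ p.re < sepAbscissa A B}

/-- Half the minimal distance between two points of `A ∪ B` (and at most `1/2`). -/
def sepRadius (A B : Set ℂ) : ℝ :=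
  sInf (insert 1 {ρ | ∃ p ∈ A ∪ B, ∃ q ∈ A ∪ B, p ≠ q ∧ ρ = dist p q}) / 2

/-- `(2πi)⁻¹ ∫_L f(s) ds`, where the contour `L` runs from `-i∞` to `+i∞` with the poles in `A` on
its left and the poles in `B` on its right.  Concretely `L` is the upward vertical line through
`sepAbscissa A B`, which has all of `A` on its left, together with small clockwise circles around
the finitely many points of `B` that also lie on the left of the line; the circles put these points
on the right of `L`.  An indented curve separating `A` from `B` is homologous to this cycle. -/
def mellinBarnes (A B : Set ℂ) (f : ℂ → ℂ) : ℂ :=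
  (2 * Real.pi * Complex.I)⁻¹ *
    ((∫ y : ℝ, f (sepAbscissa A B + y * Complex.I)) * Complex.I
      - ∑ᶠ (p : ℂ) (_ : p ∈ misplaced A B), circleIntegral f p (sepRadius A B))

/-- The support of the contour used in `mellinBarnes`. -/
def mellinBarnesContour (A B : Set ℂ) : Set ℂ :=
  {s | s.re = sepAbscissa A B} ∪ ⋃ p ∈ misplaced A B, Metric.sphere p (sepRadius A B)

/-- The two families of poles are disjoint and the integral in `mellinBarnes` converges
absolutely. -/
def MellinBarnesConverges (A B : Set ℂ) (f : ℂ → ℂ) : Prop :=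
  Disjoint A B ∧
    Integrable (fun y : ℝ => f (sepAbscissa A B + y * Complex.I)) ∧
    ∀ p ∈ misplaced A B, CircleIntegrable f p (sepRadius A B)

/-- Poles in `t` of the factors `Γ(b + s + t)` and `Γ(f + t)`. -/
def egbInnerLeft (G₁ G₃ : GammaBlock) (s : ℂ) : Set ℂ :=
  leftPoles (G₁.bNum.map (fun b => -b - s) ++ G₃.bNum.map fun f => -f)

/-- Poles in `t` of the factors `Γ(1 - a - s - t)` and `Γ(1 - e - t)`. -/
def egbInnerRight (G₁ G₃ : GammaBlock) (s : ℂ) : Set ℂ :=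
  rightPoles (G₁.aNum.map (fun a => 1 - a - s) ++ G₃.aNum.map fun e => 1 - e)

/-- Poles in `s` of the factors `Γ(d + s)`, and of the inner integral, which is singular where a
pole of `Γ(b + s + t)` meets a pole of `Γ(1 - e - t)`. -/
def egbOuterLeft (G₁ G₂ G₃ : GammaBlock) : Set ℂ :=
  leftPoles (G₂.bNum.map (fun d => -d) ++
    G₁.bNum.flatMap fun b => G₃.aNum.map fun e => e - 1 - b)

/-- Poles in `s` of the factors `Γ(1 - c - s)`, and of the inner integral, which is singular where
a pole of `Γ(1 - a - s - t)` meets a pole of `Γ(f + t)`. -/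
def egbOuterRight (G₁ G₂ G₃ : GammaBlock) : Set ℂ :=
  rightPoles (G₂.aNum.map (fun c => 1 - c) ++
    G₁.aNum.flatMap fun a => G₃.bNum.map fun f => 1 - a + f)

def egbInnerIntegrand (G₁ G₃ : GammaBlock) (y : ℝ) (s t : ℂ) : ℂ :=
  G₁.kernel (s + t) * G₃.kernel t * (y : ℂ) ^ (-t)

def egbOuterIntegrand (G₁ G₂ G₃ : GammaBlock) (x y : ℝ) (s : ℂ) : ℂ :=
  G₂.kernel s * (x : ℂ) ^ (-s) *
    mellinBarnes (egbInnerLeft G₁ G₃ s) (egbInnerRight G₁ G₃ s) (egbInnerIntegrand G₁ G₃ y s)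

/-- The extended generalized bivariate Meijer G-function `𝒢(G₁ | G₂ | G₃ | x, y)`, where the block
`G₁` has argument `s + t`, the block `G₂` argument `s` and the block `G₃` argument `t`. -/
def egbMeijerG (G₁ G₂ G₃ : GammaBlock) (x y : ℝ) : ℂ :=
  mellinBarnes (egbOuterLeft G₁ G₂ G₃) (egbOuterRight G₁ G₂ G₃) (egbOuterIntegrand G₁ G₂ G₃ x y)

/-- The integrals defining `egbMeijerG G₁ G₂ G₃ x y` converge absolutely. -/
def EGBMeijerGConverges (G₁ G₂ G₃ : GammaBlock) (x y : ℝ) : Prop :=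
  MellinBarnesConverges (egbOuterLeft G₁ G₂ G₃) (egbOuterRight G₁ G₂ G₃)
      (egbOuterIntegrand G₁ G₂ G₃ x y) ∧
    ∀ s ∈ mellinBarnesContour (egbOuterLeft G₁ G₂ G₃) (egbOuterRight G₁ G₂ G₃),
      MellinBarnesConverges (egbInnerLeft G₁ G₃ s) (egbInnerRight G₁ G₃ s)
        (egbInnerIntegrand G₁ G₃ y s)

/-! ### The closed form -/

/-- First block `G^{1,1}_{1,1}` with upper parameter `1 - α` and lower parameter `ν - α`. -/
def t6Block₁ (ν : ℝ) (α : ℕ) : GammaBlock := ⟨[1 - α], [], [ν - α], []⟩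

/-- Second block `G^{1,1}_{1,1}` with upper parameter `1 + ν` and lower parameter `0`. -/
def t6Block₂ (ν : ℝ) : GammaBlock := ⟨[1 + ν], [], [0], []⟩

/-- Third block `G^{1,0}_{0,1}` with no upper parameter and lower parameter `0`. -/
def t6Block₃ : GammaBlock := ⟨[], [], [0], []⟩

/-- `T₆(α₁, α₂, β₁, β₂)`; `P` is the normalized transmit power and `Ωh` the combination
`Ω = Ωₙ Ω_f / (Ωₙ + Ω_f)`. -/
def T6 (ν P aₛ Ωh : ℝ) (K α₁ α₂ : ℕ) (β₁ β₂ : ℝ) : ℂ :=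
  ∑ τ ∈ Finset.range α₂,
    (((2 * P / K) ^ (-((α₁ + τ : ℕ) : ℝ)) /
      (Real.Gamma α₁ * Real.Gamma ν * Real.Gamma (-ν) * β₁ ^ α₁ * β₂ ^ τ * τ.factorial) : ℝ) : ℂ) *
    egbMeijerG (t6Block₁ ν (α₁ + τ)) (t6Block₂ ν) t6Block₃ (K / 2 * aₛ) (K / (2 * Ωh * P))

/-! ### The communication system -/

/-- The law `𝒞𝒩(0, 1)`: independent real and imaginary parts, each of law `N(0, 1/2)`. -/
def stdComplexNormal : Measure ℂ :=
  ((gaussianReal 0 (1 / 2)).prod (gaussianReal 0 (1 / 2))).map fun p : ℝ × ℝ => ⟨p.1, p.2⟩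

/-- Channel gain `∑ᵢ |hᵢ|²` after maximal-ratio combining, with `hᵢ = √Ω ĥᵢ`. -/
def mrcGain {S : Type*} {N : ℕ} (Ωu : ℝ) (hhat : Fin N → S → ℂ) (ω : S) : ℝ :=
  ∑ i, ‖(√Ωu : ℂ) * hhat i ω‖ ^ 2

/-- SINR for decoding the weak user's symbol at a receiver with channel gain `g`, the strong user's
symbol being treated as noise. -/
def sinrWeakSymbol (aₛ a_w P g : ℝ) : ℝ := a_w * P * g / (1 + aₛ * P * g)

/-- Effective rate `-(1/ν) log₂ E[(1 + γ)^{-ν}]`. -/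
def effectiveRate {S : Type*} [MeasurableSpace S] (μ : Measure S) (ν : ℝ) (γ : S → ℝ) : ℝ :=
  -(1 / ν) * Real.logb 2 (∫ ω, (1 + γ ω) ^ (-ν) ∂μ)

/-- Instantaneous secondary-link CSI: the weak user is the one with the smaller gain, and its SINR
is the one at that user. -/
def sinrWeakInstantaneous {S : Type*} (aₛ a_w P : ℝ) (gn gf : S → ℝ) (ω : S) : ℝ :=
  sinrWeakSymbol aₛ a_w P (min (gn ω) (gf ω))

/-- Statistical secondary-link CSI: the weak user is fixed to be the far user, and its symbol has
to be decoded both at the near (strong) user and at the far (weak) user, so that the smaller of the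
two SINRs counts. -/
def sinrWeakStatistical {S : Type*} (aₛ a_w P : ℝ) (gn gf : S → ℝ) (ω : S) : ℝ :=
  min (sinrWeakSymbol aₛ a_w P (gn ω)) (sinrWeakSymbol aₛ a_w P (gf ω))

end

/-!
Write `u = (2P/K) g`. Since `aₛ + a_w = 2/K`, the weak user's symbol is received with
`1 + γ = (1 + u) / (1 + (K/2) aₛ u)`. The gains are independent and Gamma distributed with integer
shape, so the tail of either one is an exponential times a polynomial, and conditioning on which
gain is the smaller writes `E[(1 + γ)^(-ν)]` as a finite sum of integrals
`∫ u^(α-1) e^(-yu) (1 + u)^(-ν) (1 + xu)^ν du`, with `x = (K/2) aₛ` and `y = K/(2ΩP)`.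

Each of these is a bivariate Meijer G-function. On the one hand `(1 + xu)^ν` is the Mellin–Barnes
integral of `Γ(s) Γ(-ν-s) (xu)^(-s) / Γ(-ν)`; since `ν > 0`, no vertical line separates the poles of
the two Gamma factors, and the finitely many poles at `-ν, -ν+1, …` to the left of the chosen line
contribute residues that complete the integral over the line. On the other hand the remaining
Mellin transform of `e^(-yu) (1 + u)^(-ν)` is, by Mellin's convolution formula, the inner integral.
-/

section

open Set Filter Topology Complex
open scoped Real

/-! ### The Gamma function on vertical lines -/

theorem norm_Gamma_le_Gamma_re {z : ℂ} (hz : 0 < z.re) : ‖Gamma z‖ ≤ Real.Gamma z.re := by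
  rw [Gamma_eq_integral hz, GammaIntegral, Real.Gamma_eq_integral hz]
  refine (norm_integral_le_integral_norm _).trans_eq
    (setIntegral_congr_fun measurableSet_Ioi fun x hx => ?_)
  simp [norm_cpow_eq_rpow_re_of_pos (mem_Ioi.1 hx), norm_exp]

theorem exists_norm_Gamma_vertical_le {c : ℝ} (hc : ∀ k : ℕ, c ≠ -k) :
    ∃ C : ℝ, ∀ v : ℝ, ‖Gamma (c + v * I)‖ ≤ C := by
  obtain ⟨n, hn⟩ := exists_nat_gt (-c)
  induction n generalizing c with
  | zero =>
    have hc0 : 0 < c := by simpa using hn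
    exact ⟨Real.Gamma c, fun v => by
      simpa using norm_Gamma_le_Gamma_re (z := c + v * I) (by simpa using hc0)⟩
  | succ n ih =>
    obtain ⟨C, hC⟩ := ih (c := c + 1) (fun k hk => hc (k + 1) (by push_cast; linarith))
      (by push_cast at hn; linarith)
    have hc0 : c ≠ 0 := by simpa using hc 0
    refine ⟨C / |c|, fun v => ?_⟩
    have hre : |c| ≤ ‖(c + v * I : ℂ)‖ := by simpa using abs_re_le_norm (c + v * I : ℂ)
    have hne : (c + v * I : ℂ) ≠ 0 := norm_pos_iff.1 ((abs_pos.2 hc0).trans_le hre)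
    rw [le_div_iff₀ (abs_pos.2 hc0)]
    calc ‖Gamma (c + v * I)‖ * |c| ≤ ‖Gamma (c + v * I)‖ * ‖(c + v * I : ℂ)‖ := by gcongr
      _ = ‖Gamma ((c + 1 : ℝ) + v * I)‖ := by
        rw [mul_comm, ← norm_mul, ← Gamma_add_one _ hne]; push_cast; ring_nf
      _ ≤ C := hC v

theorem continuous_Gamma_vertical {c : ℝ} (hc : ∀ k : ℕ, c ≠ -k) :
    Continuous fun v : ℝ => Gamma (c + v * I) := by
  refine continuous_iff_continuousAt.2 fun v => ContinuousAt.comp (g := Gamma)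
    (differentiableAt_Gamma _ fun m hm => hc m ?_).continuousAt (by fun_prop)
  simpa using congrArg re hm

theorem one_add_sq_le_norm_mul_add_one {c : ℝ} (h0 : c ≠ 0) (h1 : c + 1 ≠ 0) (v : ℝ) :
    1 + v ^ 2 ≤ (1 + |c * (c + 1)|⁻¹) * ‖(c + v * I : ℂ) * ((c + v * I) + 1)‖ := by
  have hre : |c * (c + 1)| ≤ ‖(c + v * I : ℂ) * ((c + v * I) + 1)‖ := by
    rw [abs_mul, norm_mul]
    gcongr
    · simpa using abs_re_le_norm (c + v * I : ℂ)
    · simpa using abs_re_le_norm (c + v * I + 1 : ℂ)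
  have him : v ^ 2 ≤ ‖(c + v * I : ℂ) * ((c + v * I) + 1)‖ := by
    rw [← sq_abs, sq, norm_mul]
    gcongr
    · simpa using abs_im_le_norm (c + v * I : ℂ)
    · simpa using abs_im_le_norm (c + v * I + 1 : ℂ)
  have hpos : 0 < |c * (c + 1)| := abs_pos.2 (mul_ne_zero h0 h1)
  calc 1 + v ^ 2 = |c * (c + 1)|⁻¹ * |c * (c + 1)| + v ^ 2 := by rw [inv_mul_cancel₀ hpos.ne']
    _ ≤ |c * (c + 1)|⁻¹ * ‖(c + v * I : ℂ) * ((c + v * I) + 1)‖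
        + ‖(c + v * I : ℂ) * ((c + v * I) + 1)‖ := by gcongr
    _ = _ := by ring

theorem verticalIntegrable_Gamma {c : ℝ} (hc : ∀ k : ℕ, c ≠ -k) : VerticalIntegrable Gamma c := by
  have h0 : c ≠ 0 := by simpa using hc 0
  have h1 : c + 1 ≠ 0 := fun h => hc 1 (by push_cast; linarith)
  obtain ⟨C, hC⟩ := exists_norm_Gamma_vertical_le (c := c + 2) fun k hk => hc (k + 2) (by
    push_cast; linarith)
  refine (integrable_inv_one_add_sq.const_mul (C * (1 + |c * (c + 1)|⁻¹))).mono'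
    (continuous_Gamma_vertical hc).aestronglyMeasurable (ae_of_all _ fun v => ?_)
  have hz0 : (c + v * I : ℂ) ≠ 0 := fun h => h0 (by simpa using congrArg re h)
  have hz1 : (c + v * I : ℂ) + 1 ≠ 0 := fun h => h1 (by simpa using congrArg re h)
  have hshift : (c + v * I : ℂ) * ((c + v * I) + 1) * Gamma (c + v * I) =
      Gamma ((c + 2 : ℝ) + v * I) := by
    rw [mul_comm (c + v * I : ℂ), mul_assoc, ← Gamma_add_one _ hz0, ← Gamma_add_one _ hz1]
    push_cast; ring_nf
  rw [← div_eq_mul_inv, le_div_iff₀ (by positivity)]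
  calc ‖Gamma (c + v * I)‖ * (1 + v ^ 2)
      ≤ ‖Gamma (c + v * I)‖ *
        ((1 + |c * (c + 1)|⁻¹) * ‖(c + v * I : ℂ) * ((c + v * I) + 1)‖) := by
        gcongr; exact one_add_sq_le_norm_mul_add_one h0 h1 v
    _ = ‖Gamma ((c + 2 : ℝ) + v * I)‖ * (1 + |c * (c + 1)|⁻¹) := by
        rw [← hshift, norm_mul _ (Gamma _)]; ring
    _ ≤ C * (1 + |c * (c + 1)|⁻¹) := by gcongr; exact hC v

theorem verticalIntegrable_Gamma_mul_Gamma_sub {c : ℝ} {a : ℂ} (hc : ∀ k : ℕ, c ≠ -k)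
    (ha : ∀ k : ℕ, a.re - c ≠ -k) : VerticalIntegrable (fun s => Gamma s * Gamma (a - s)) c := by
  obtain ⟨C, hC⟩ := exists_norm_Gamma_vertical_le ha
  have hreflect (v : ℝ) : a - (c + v * I) = (a.re - c : ℝ) + (a.im - v : ℝ) * I :=
    Complex.ext (by simp) (by simp)
  refine (verticalIntegrable_Gamma hc).mul_bdd (c := C) (Continuous.aestronglyMeasurable ?_)
    (ae_of_all _ fun v => ?_)
  · simp_rw [hreflect]
    exact (continuous_Gamma_vertical ha).comp (continuous_const.sub continuous_id)
  · rw [hreflect]; exact hC _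

/-! ### Mellin transforms -/

theorem mellinInv_congr {f g : ℂ → ℂ} {c : ℝ} (h : ∀ s : ℂ, s.re = c → f s = g s) :
    mellinInv c f = mellinInv c g := by
  ext x
  simp only [mellinInv]
  congr 2 with v
  rw [h _ (by simp)]

theorem mellinInv_eq_of_eq_mellin {f : ℝ → ℂ} {φ : ℂ → ℂ} {c x : ℝ} (hx : 0 < x)
    (hf : MellinConvergent f c) (hφ : VerticalIntegrable φ c) (hcont : ContinuousAt f x)
    (h : ∀ s : ℂ, s.re = c → φ s = mellin f s) : mellinInv c φ x = f x := by
  rw [mellinInv_congr h]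
  refine mellinInv_mellin_eq c f hx hf (hφ.congr (ae_of_all _ fun v => ?_)) hcont
  exact h _ (by simp)

theorem mellinInv_Gamma {c x : ℝ} (hc : 0 < c) (hx : 0 < x) : mellinInv c Gamma x = exp (-x) := by
  refine mellinInv_eq_of_eq_mellin (f := fun t => exp (-t)) hx ?_
    (verticalIntegrable_Gamma fun k hk => ?_) (by fun_prop) fun s hs => ?_
  · refine (GammaIntegral_convergent (s := c) (by simpa using hc)).congr_fun (fun t _ => ?_)
      measurableSet_Ioi
    simp [mul_comm]
  · linarith [k.cast_nonneg (α := ℝ)]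
  · rw [Gamma_eq_integral (hs ▸ hc), GammaIntegral_eq_mellin]
    simp

theorem verticalIntegrable_cpow_neg_mul {φ : ℂ → ℂ} {c x : ℝ} (hφ : VerticalIntegrable φ c)
    (hx : 0 < x) : VerticalIntegrable (fun s => (x : ℂ) ^ (-s) * φ s) c := by
  refine hφ.bdd_mul (c := x ^ (-c)) (Continuous.aestronglyMeasurable ?_) (ae_of_all _ fun v => ?_)
  · exact Continuous.const_cpow (by fun_prop) (Or.inl (by exact_mod_cast hx.ne'))
  · simp [norm_cpow_eq_rpow_re_of_pos hx]

theorem cpow_sub_vertical {u : ℝ} (hu : 0 < u) (q : ℂ) (c v : ℝ) :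
    (u : ℂ) ^ (q - (c + v * I) - 1) = (u : ℂ) ^ (q - c - 1) * exp (↑(-(v * Real.log u)) * I) := by
  have hu0 : (u : ℂ) ≠ 0 := by exact_mod_cast hu.ne'
  rw [show q - (c + v * I) - 1 = (q - c - 1) + -(v * I) by ring, cpow_add _ _ hu0,
    cpow_def_of_ne_zero hu0 (-(v * I)), ← ofReal_log hu.le]
  push_cast
  ring_nf

theorem integrable_mellin_convolution {φ : ℂ → ℂ} {h : ℝ → ℂ} {c : ℝ} {q : ℂ}
    (hφ : VerticalIntegrable φ c) (hh : MellinConvergent h (q - c)) :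
    Integrable (fun p : ℝ × ℝ => φ (c + p.1 * I) *
      ((p.2 : ℂ) ^ (q - (c + p.1 * I) - 1) • h p.2)) (volume.prod (volume.restrict (Ioi 0))) := by
  have hprod : Integrable (fun p : ℝ × ℝ => φ (c + p.1 * I) * ((p.2 : ℂ) ^ (q - c - 1) • h p.2) *
      exp (↑(-(p.1 * Real.log p.2)) * I)) (volume.prod (volume.restrict (Ioi 0))) := by
    refine (Integrable.mul_prod (L := ℂ) hφ hh).mul_bdd (c := 1) ?_ (ae_of_all _ fun p => ?_)
    · exact Measurable.aestronglyMeasurable (by fun_prop)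
    · rw [norm_exp_ofReal_mul_I]
  refine hprod.congr ?_
  have hpos : ∀ᵐ p : ℝ × ℝ ∂volume.prod (volume.restrict (Ioi 0)), 0 < p.2 :=
    Measure.quasiMeasurePreserving_snd.ae (ae_restrict_mem measurableSet_Ioi)
  filter_upwards [hpos] with p hp
  rw [cpow_sub_vertical hp, smul_eq_mul, smul_eq_mul]
  ring

theorem verticalIntegrable_mul_mellin_sub {φ : ℂ → ℂ} {h : ℝ → ℂ} {c : ℝ} {q : ℂ}
    (hφ : VerticalIntegrable φ c) (hh : MellinConvergent h (q - c)) :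
    VerticalIntegrable (fun s => φ s * mellin h (q - s)) c := by
  refine (integrable_mellin_convolution hφ hh).integral_prod_left.congr (ae_of_all _ fun v => ?_)
  exact integral_const_mul (φ (c + v * I)) _

theorem mellinInv_mul_mellin_sub {φ : ℂ → ℂ} {h : ℝ → ℂ} {c x : ℝ} {q : ℂ}
    (hφ : VerticalIntegrable φ c) (hh : MellinConvergent h (q - c)) (hx : 0 < x) :
    mellinInv c (fun s => φ s * mellin h (q - s)) x =
      mellin (fun u => mellinInv c φ (x * u) * h u) q := by
  have hF := integrable_mellin_convolution (verticalIntegrable_cpow_neg_mul hφ hx) hh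
  have hkernel (u : ℝ) (hu : 0 < u) (s : ℂ) :
      (x : ℂ) ^ (-s) * φ s * ((u : ℂ) ^ (q - s - 1) • h u) =
        ((x * u : ℝ) : ℂ) ^ (-s) * φ s * ((u : ℂ) ^ (q - 1) * h u) := by
    have hu0 : (u : ℂ) ≠ 0 := by exact_mod_cast hu.ne'
    rw [ofReal_mul, mul_cpow_ofReal_nonneg hx.le hu.le, smul_eq_mul,
      show q - s - 1 = (q - 1) + -s by ring, cpow_add _ _ hu0]
    ring
  calc mellinInv c (fun s => φ s * mellin h (q - s)) x
      = (1 / (2 * π) : ℝ) • ∫ v : ℝ, ∫ u in Ioi (0 : ℝ), (x : ℂ) ^ (-(c + v * I)) * φ (c + v * I) *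
          ((u : ℂ) ^ (q - (c + v * I) - 1) • h u) := by
        simp only [mellinInv, mellin, integral_const_mul, smul_eq_mul, mul_assoc]
    _ = (1 / (2 * π) : ℝ) • ∫ u in Ioi (0 : ℝ), ∫ v : ℝ, (x : ℂ) ^ (-(c + v * I)) *
          φ (c + v * I) * ((u : ℂ) ^ (q - (c + v * I) - 1) • h u) := by
        rw [integral_integral_swap hF]
    _ = mellin (fun u => mellinInv c φ (x * u) * h u) q := by
        rw [mellin, ← integral_smul]
        refine setIntegral_congr_fun measurableSet_Ioi fun u hu => ?_
        simp_rw [hkernel u hu, integral_mul_const, mellinInv, smul_eq_mul, real_smul]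
        ring

/-! ### The beta integral over the half line -/

theorem image_div_one_sub_Ioo : (fun x : ℝ => x / (1 - x)) '' Ioo 0 1 = Ioi 0 := by
  ext u
  constructor
  · rintro ⟨x, hx, rfl⟩
    exact div_pos hx.1 (sub_pos.2 hx.2)
  · intro hu
    have hu1 : 0 < 1 + u := by linarith [mem_Ioi.1 hu]
    refine ⟨u / (1 + u), ⟨div_pos hu hu1, (div_lt_one hu1).2 (by linarith)⟩, ?_⟩
    have : 1 - u / (1 + u) = (1 + u)⁻¹ := by field_simp; ring
    simp only [this, div_inv_eq_mul, div_mul_cancel₀ _ hu1.ne']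

theorem injOn_div_one_sub : InjOn (fun x : ℝ => x / (1 - x)) (Ioo 0 1) := by
  intro x hx y hy hxy
  rw [div_eq_div_iff (sub_pos.2 hx.2).ne' (sub_pos.2 hy.2).ne'] at hxy
  linarith

theorem hasDerivAt_div_one_sub {x : ℝ} (hx : x ≠ 1) :
    HasDerivAt (fun x : ℝ => x / (1 - x)) ((1 - x) ^ 2)⁻¹ x := by
  have h1 : 1 - x ≠ 0 := sub_ne_zero.2 hx.symm
  refine ((hasDerivAt_id x).div ((hasDerivAt_id x).const_sub 1) h1).congr_deriv ?_
  simp [field]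

theorem abs_deriv_smul_beta_integrand (a q : ℂ) {x : ℝ} (hx : x ∈ Ioo 0 1) :
    |((1 - x) ^ 2)⁻¹| • (((x / (1 - x) : ℝ) : ℂ) ^ (q - 1) • (1 + (x / (1 - x) : ℝ) : ℂ) ^ (-a)) =
      (x : ℂ) ^ (q - 1) * (1 - x : ℂ) ^ (a - q - 1) := by
  have hx1 : 0 < 1 - x := sub_pos.2 hx.2
  have h0 : ((1 - x : ℝ) : ℂ) ≠ 0 := by exact_mod_cast hx1.ne'
  have hbase : (1 - x : ℂ) = (1 - x : ℝ) := by push_cast; ring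
  have hadd : (1 + (x / (1 - x) : ℝ) : ℂ) = ((1 - x)⁻¹ : ℝ) := by
    have : 1 + x / (1 - x) = (1 - x)⁻¹ := by field_simp; ring
    exact_mod_cast this
  have hinv (b : ℂ) : (((1 - x)⁻¹ : ℝ) : ℂ) ^ b = ((1 - x : ℝ) : ℂ) ^ (-b) := by
    rw [ofReal_inv, inv_cpow _ _ (by rw [arg_ofReal_of_nonneg hx1.le]; exact Real.pi_pos.ne),
      cpow_neg]
  have hsq : (((1 - x) ^ 2 : ℝ) : ℂ)⁻¹ = ((1 - x : ℝ) : ℂ) ^ (-2 : ℂ) := by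
    rw [cpow_neg, ofReal_pow]; norm_cast
  rw [abs_of_nonneg (by positivity), hadd, div_eq_mul_inv, ofReal_mul,
    mul_cpow_ofReal_nonneg hx.1.le (inv_nonneg.2 hx1.le), hinv, hinv, real_smul, smul_eq_mul,
    ofReal_inv, hsq, hbase,
    show a - q - 1 = -2 + -(q - 1) + - -a by ring, cpow_add _ _ h0, cpow_add _ _ h0]
  ring

theorem mellinConvergent_one_add_cpow_neg {a q : ℂ} (hq : 0 < q.re) (hqa : q.re < a.re) :
    MellinConvergent (fun u => (1 + u : ℂ) ^ (-a)) q := by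
  rw [MellinConvergent, ← image_div_one_sub_Ioo,
    integrableOn_image_iff_integrableOn_abs_deriv_smul measurableSet_Ioo
      (fun x hx => (hasDerivAt_div_one_sub hx.2.ne).hasDerivWithinAt) injOn_div_one_sub,
    integrableOn_congr_fun (fun x hx => abs_deriv_smul_beta_integrand a q hx) measurableSet_Ioo,
    ← integrableOn_Ioc_iff_integrableOn_Ioo,
    ← intervalIntegrable_iff_integrableOn_Ioc_of_le zero_le_one]
  exact betaIntegral_convergent hq (by simpa using hqa)

theorem Gamma_mul_mellin_one_add_cpow_neg {a q : ℂ} (hq : 0 < q.re) (hqa : q.re < a.re) :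
    Gamma a * mellin (fun u => (1 + u : ℂ) ^ (-a)) q = Gamma q * Gamma (a - q) := by
  rw [Gamma_mul_Gamma_eq_betaIntegral hq (by simpa using hqa), add_sub_cancel, betaIntegral,
    intervalIntegral.integral_of_le zero_le_one, integral_Ioc_eq_integral_Ioo,
    ← setIntegral_congr_fun measurableSet_Ioo
      (fun x hx => abs_deriv_smul_beta_integrand a q hx), mellin, ← image_div_one_sub_Ioo,
    integral_image_eq_integral_abs_deriv_smul measurableSet_Ioo
      (fun x hx => (hasDerivAt_div_one_sub hx.2.ne).hasDerivWithinAt) injOn_div_one_sub]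

theorem mellinInv_Gamma_mul_Gamma_sub {a : ℂ} {c x : ℝ} (hc : 0 < c) (hca : c < a.re)
    (hx : 0 < x) :
    mellinInv c (fun s => Gamma s * Gamma (a - s)) x = Gamma a * (1 + x : ℂ) ^ (-a) := by
  refine mellinInv_eq_of_eq_mellin (f := fun u => Gamma a * (1 + u : ℂ) ^ (-a)) hx
    ((mellinConvergent_one_add_cpow_neg (by simpa using hc) (by simpa using hca)).const_smul
      (Gamma a))
    (verticalIntegrable_Gamma_mul_Gamma_sub (fun k hk => ?_) fun k hk => ?_) ?_ fun s hs => ?_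
  · linarith [k.cast_nonneg (α := ℝ)]
  · linarith [k.cast_nonneg (α := ℝ)]
  · refine continuousAt_const.mul (ContinuousAt.cpow (by fun_prop) continuousAt_const (Or.inl ?_))
    simp only [add_re, one_re, ofReal_re]
    linarith
  · rw [← Gamma_mul_mellin_one_add_cpow_neg (hs ▸ hc) (hs ▸ hca)]
    exact (mellin_const_smul _ s (Gamma a)).symm

/-! ### Mellin–Barnes integrals of powers of `1 + z` -/

/-- `Γ(a)` times the remainder of the binomial series of `(1 + w) ^ (-a)` after `n` terms. -/
noncomputable def binomialRemainder (a : ℂ) (n : ℕ) (w : ℝ) : ℂ :=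
  Gamma a * (1 + w : ℂ) ^ (-a) -
    ∑ k ∈ Finset.range n, (-1) ^ k / k.factorial * Gamma (a + k) * w ^ k

theorem binomialRemainder_succ_zero (a : ℂ) (n : ℕ) : binomialRemainder a (n + 1) 0 = 0 := by
  simp [binomialRemainder, Finset.sum_range_succ']

theorem hasDerivAt_binomialRemainder_succ {a : ℂ} (ha : a ≠ 0) (n : ℕ) {w : ℝ} (hw : -1 < w) :
    HasDerivAt (binomialRemainder a (n + 1)) (-binomialRemainder (a + 1) n w) w := by
  have hpow : HasDerivAt (fun w : ℝ => (1 + w : ℂ) ^ (-a)) (-a * (1 + w : ℂ) ^ (-(a + 1))) w := by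
    have hslit : (1 + w : ℂ) ∈ slitPlane := Or.inl (by
      simp only [add_re, one_re, ofReal_re]; linarith)
    have hpowC : HasDerivAt (fun z : ℂ => (1 + z) ^ (-a)) (-a * (1 + w) ^ (-a - 1) * 1) w :=
      ((hasDerivAt_id (w : ℂ)).const_add 1).cpow_const hslit
    exact hpowC.comp_ofReal.congr_deriv (by rw [neg_add', mul_one])
  have hsum : HasDerivAt (fun w : ℝ => ∑ k ∈ Finset.range (n + 1),
      ((-1) ^ k / k.factorial * Gamma (a + k) * w ^ k : ℂ))
      (∑ k ∈ Finset.range (n + 1),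
        ((-1) ^ k / k.factorial * Gamma (a + k) * (k * w ^ (k - 1)) : ℂ)) w :=
    HasDerivAt.fun_sum fun k _ => (hasDerivAt_pow k (w : ℂ)).comp_ofReal.const_mul _
  refine ((hpow.const_mul (Gamma a)).sub hsum).congr_deriv ?_
  have hterm (k : ℕ) : (-1 : ℂ) ^ (k + 1) / (k + 1).factorial * Gamma (a + (k + 1 : ℕ)) *
      ((k + 1 : ℕ) * w ^ k) = -((-1) ^ k / k.factorial * Gamma (a + 1 + k) * w ^ k) := by
    have hk : (k.factorial : ℂ) ≠ 0 := by exact_mod_cast k.factorial_ne_zero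
    have hk1 : (k + 1 : ℂ) ≠ 0 := by exact_mod_cast k.succ_ne_zero
    rw [Nat.factorial_succ, show a + (k + 1 : ℕ) = a + 1 + k by push_cast; ring]
    push_cast
    field_simp
    ring
  simp only [Finset.sum_range_succ', binomialRemainder, add_tsub_cancel_right, hterm,
    Finset.sum_neg_distrib, Gamma_add_one a ha, Nat.cast_zero, zero_mul, mul_zero, add_zero]
  ring

theorem integral_binomialRemainder {a : ℂ} (ha : a ≠ 0) (n : ℕ) {w : ℝ} (hw : 0 ≤ w) :
    ∫ x in (0 : ℝ)..w, binomialRemainder (a + 1) n x = -binomialRemainder a (n + 1) w := by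
  have hcont : ContinuousOn (binomialRemainder (a + 1) n) (uIcc 0 w) := fun x hx => by
    rw [uIcc_of_le hw] at hx
    have hslit : (1 + x : ℂ) ∈ slitPlane := Or.inl (by
      simp only [add_re, one_re, ofReal_re]; linarith [hx.1])
    unfold binomialRemainder
    refine (ContinuousAt.sub (continuousAt_const.mul ?_) (by fun_prop)).continuousWithinAt
    exact ContinuousAt.cpow (by fun_prop) continuousAt_const hslit
  have hFTC := intervalIntegral.integral_eq_sub_of_hasDerivAt
    (fun x hx => hasDerivAt_binomialRemainder_succ ha n (w := x) (by
      rw [uIcc_of_le hw] at hx; linarith [hx.1])) hcont.neg.intervalIntegrable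
  rw [intervalIntegral.integral_neg, binomialRemainder_succ_zero, sub_zero] at hFTC
  rw [← hFTC, neg_neg]

theorem mellinInv_add_comp_sub (ψ : ℂ → ℂ) (c b : ℝ) {x : ℝ} (hx : 0 < x) :
    mellinInv (c + b) (fun s => ψ (s - b)) x = (x : ℂ) ^ (-b : ℂ) * mellinInv c ψ x := by
  simp only [mellinInv, real_smul, smul_eq_mul]
  rw [mul_left_comm, ← integral_const_mul ((x : ℂ) ^ (-b : ℂ))]
  congr 2 with v
  rw [ofReal_add, show -(c + b + v * I : ℂ) = -b + -(c + v * I) by ring,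
    cpow_add _ _ (by exact_mod_cast hx.ne'), add_right_comm, add_sub_cancel_right, mul_assoc]

theorem mellinInv_comp_const_sub (ψ : ℂ → ℂ) (c : ℝ) (b : ℂ) {x : ℝ} (hx : 0 < x) :
    mellinInv c (fun s => ψ (b - s)) x = (x : ℂ) ^ (-b) * mellinInv (b.re - c) ψ x⁻¹ := by
  simp only [mellinInv, real_smul, smul_eq_mul]
  rw [mul_left_comm, ← integral_const_mul ((x : ℂ) ^ (-b)),
    ← integral_sub_left_eq_self _ volume b.im]
  congr 2 with v
  have hreflect : b - (c + (b.im - v : ℝ) * I) = (b.re - c : ℝ) + v * I :=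
    Complex.ext (by simp) (by simp)
  rw [hreflect, ← mul_assoc, ofReal_inv, inv_cpow _ _ (by
    rw [arg_ofReal_of_nonneg hx.le]; exact Real.pi_pos.ne), ← cpow_neg, neg_neg,
    ← cpow_add _ _ (by exact_mod_cast hx.ne'), ← hreflect]
  ring_nf

theorem mellinInv_neg (φ : ℂ → ℂ) (c x : ℝ) : mellinInv c (fun s => -φ s) x = -mellinInv c φ x := by
  simp only [mellinInv, smul_neg, integral_neg]

theorem integral_mellinInv {φ : ℂ → ℂ} {c x : ℝ} (hφ : VerticalIntegrable φ c) (hc : c < 1)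
    (hx : 0 < x) :
    ∫ t in (0 : ℝ)..x, mellinInv c φ t = x * mellinInv c (fun s => φ s * (1 / (1 - s))) x := by
  have hind (s : ℂ) (hs : s.re = c) := hasMellin_one_Ioc (s := 1 - s) (by simp [hs, hc])
  calc ∫ t in (0 : ℝ)..x, mellinInv c φ t
      = x * ∫ u in (0 : ℝ)..1, mellinInv c φ (x * u) := by
        have := intervalIntegral.smul_integral_comp_mul_left (a := 0) (b := 1) (mellinInv c φ) x
        rw [← real_smul, this, mul_zero, mul_one]
    _ = x * mellin (fun u => mellinInv c φ (x * u) * indicator (Ioc 0 1) (fun _ => 1) u) 1 := by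
        rw [intervalIntegral.integral_of_le zero_le_one, mellin]
        simp_rw [sub_self, cpow_zero, one_smul,
          ← indicator_mul_right (Ioc 0 1) (fun u => mellinInv c φ (x * u)), mul_one]
        rw [setIntegral_indicator measurableSet_Ioc, inter_eq_self_of_subset_right
          Ioc_subset_Ioi_self]
    _ = x * mellinInv c (fun s => φ s * mellin (indicator (Ioc 0 1) fun _ => 1) (1 - s)) x := by
        rw [mellinInv_mul_mellin_sub hφ (hind c (by simp)).1 hx]
    _ = x * mellinInv c (fun s => φ s * (1 / (1 - s))) x := by
        rw [mellinInv_congr fun s hs => by rw [(hind s hs).2]]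

/-- The line `re s = c` has the poles `0, -1, …, -(n - 1)` of `Γ(s)` on its right;
their residues are the `n` terms of the binomial series that are subtracted. -/
theorem mellinInv_Gamma_mul_Gamma_sub_eq_binomialRemainder {a : ℂ} (ha : ∀ k : ℕ, a ≠ -k) {n : ℕ}
    {c : ℝ} (hc : -n < c) (hcn : c < 1 - n) (hca : c < a.re) {w : ℝ} (hw : 0 < w) :
    mellinInv c (fun s => Gamma s * Gamma (a - s)) w = binomialRemainder a n w := by
  induction n generalizing a c w with
  | zero =>
    simpa [binomialRemainder] using mellinInv_Gamma_mul_Gamma_sub (by simpa using hc) hca hw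
  | succ n ih =>
    push_cast at hc hcn
    have ha1 (k : ℕ) : a + 1 ≠ -k := fun h => ha (k + 1) (by
      push_cast; linear_combination h)
    have hvert : VerticalIntegrable (fun s => Gamma s * Gamma (a + 1 - s)) (c + 1) := by
      refine verticalIntegrable_Gamma_mul_Gamma_sub (fun k hk => ?_) fun k hk => ?_
      · have h1 : (k : ℝ) < n := by linarith
        have h2 : (n : ℝ) < k + 1 := by linarith
        norm_cast at h1 h2
        lia
      · simp only [add_re, one_re] at hk
        linarith [k.cast_nonneg (α := ℝ)]
    have hstep (s : ℂ) (hs : s.re = c + 1) : Gamma s * Gamma (a + 1 - s) * (1 / (1 - s)) =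
        -(Gamma (s - (1 : ℝ)) * Gamma (a - (s - (1 : ℝ)))) := by
      have hs1 : s - 1 ≠ 0 := fun h => by
        have := congrArg re h
        simp only [sub_re, one_re, hs, zero_re] at this
        linarith [n.cast_nonneg (α := ℝ)]
      have hΓ := Gamma_add_one _ hs1
      rw [sub_add_cancel] at hΓ
      rw [hΓ, show a + 1 - s = a - (s - 1) by ring, ofReal_one, ← neg_sub s 1]
      field_simp
    have hcont := integral_mellinInv hvert (by linarith [n.cast_nonneg (α := ℝ)]) hw
    rw [mellinInv_congr hstep, mellinInv_neg, mellinInv_add_comp_sub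
      (fun s => Gamma s * Gamma (a - s)) c 1 hw, ofReal_one, cpow_neg_one, mul_neg,
      mul_inv_cancel_left₀ (by exact_mod_cast hw.ne')] at hcont
    rw [← neg_inj, ← hcont, ← integral_binomialRemainder (by simpa using ha 0) n hw.le,
      intervalIntegral.integral_of_le hw.le, intervalIntegral.integral_of_le hw.le]
    refine setIntegral_congr_fun measurableSet_Ioc fun x hx => ?_
    refine ih ha1 (by linarith) (by linarith) ?_ hx.1
    simpa using hca

theorem mellinInv_Gamma_mul_Gamma_neg_sub {ν : ℂ} (hν : ∀ k : ℕ, ν ≠ k) {n : ℕ} {σ : ℝ}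
    (hσ : 0 < σ) (hn : n - 1 < ν.re + σ) (hn' : ν.re + σ < n) {x : ℝ} (hx : 0 < x) :
    mellinInv σ (fun s => Gamma s * Gamma (-ν - s)) x = Gamma (-ν) * (1 + x : ℂ) ^ ν -
      ∑ k ∈ Finset.range n, (-1) ^ k / k.factorial * Gamma (k - ν) * (x : ℂ) ^ (ν - k) := by
  have hx0 : (x : ℂ) ≠ 0 := by exact_mod_cast hx.ne'
  have hreflect := mellinInv_comp_const_sub (fun s => Gamma s * Gamma (-ν - s)) σ (-ν) hx
  simp only [sub_sub_cancel, neg_neg, neg_re, mul_comm (Gamma (-ν - _))] at hreflect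
  rw [hreflect, mellinInv_Gamma_mul_Gamma_sub_eq_binomialRemainder (n := n) ?_ (by linarith)
      (by linarith) (by simpa using hσ) (inv_pos.2 hx), binomialRemainder, mul_sub, Finset.mul_sum]
  · congr 1
    · have hinv : (1 + ↑x⁻¹ : ℂ) = (1 + x⁻¹ : ℝ) := by push_cast; rfl
      rw [mul_left_comm, neg_neg, hinv, ← mul_cpow_ofReal_nonneg hx.le (by positivity),
        ← ofReal_mul, mul_add, mul_inv_cancel₀ hx.ne', mul_one, add_comm, ofReal_add, ofReal_one]
    · refine Finset.sum_congr rfl fun k _ => ?_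
      rw [cpow_sub _ _ hx0, cpow_natCast, neg_add_eq_sub, ofReal_inv, inv_pow]
      ring
  · exact fun k hk => hν k (by simpa using hk)

/-! ### The Mellin–Barnes integrals of the Meijer kernel -/

theorem isBigO_exp_neg_mul_mul {g : ℝ → ℂ} {b y : ℝ} (hy : 0 < y)
    (hgO : g =O[atTop] fun u => u ^ b) :
    (fun u : ℝ => exp (-(y * u)) * g u) =O[atTop] fun u => Real.exp (-(y / 2) * u) := by
  have hexp : (fun u : ℝ => exp (-(y * u))) =O[atTop] fun u => Real.exp (-y * u) :=
    Asymptotics.isBigO_of_le _ fun u => by simp [norm_exp]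
  exact (hexp.mul hgO).trans (isLittleO_exp_mul_rpow_of_lt b (by linarith)).isBigO

theorem locallyIntegrableOn_exp_neg_mul_mul {g : ℝ → ℂ} (hg : ContinuousOn g (Ici 0)) (y : ℝ) :
    LocallyIntegrableOn (fun u : ℝ => exp (-(y * u)) * g u) (Ioi 0) :=
  (ContinuousOn.mul (by fun_prop) (hg.mono Ioi_subset_Ici_self)).locallyIntegrableOn
    measurableSet_Ioi

theorem isBigO_one_exp_neg_mul_mul {g : ℝ → ℂ} (hg : ContinuousOn g (Ici 0)) (y : ℝ) :
    (fun u : ℝ => exp (-(y * u)) * g u) =O[𝓝[>] 0] fun u => u ^ (-(0 : ℝ)) := by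
  have hlim : ContinuousWithinAt (fun u : ℝ => exp (-(y * u)) * g u) (Ioi 0) 0 :=
    ContinuousWithinAt.mul (by fun_prop) ((hg 0 self_mem_Ici).mono Ioi_subset_Ici_self)
  simpa only [neg_zero, Real.rpow_zero] using hlim.tendsto.isBigO_one ℝ

theorem mellinConvergent_exp_neg_mul_mul {g : ℝ → ℂ} {b y : ℝ} (hg : ContinuousOn g (Ici 0))
    (hgO : g =O[atTop] fun u => u ^ b) (hy : 0 < y) {q : ℂ} (hq : 0 < q.re) :
    MellinConvergent (fun u : ℝ => exp (-(y * u)) * g u) q :=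
  mellinConvergent_of_isBigO_rpow_exp (half_pos hy) (locallyIntegrableOn_exp_neg_mul_mul hg y)
    (isBigO_exp_neg_mul_mul hy hgO) (isBigO_one_exp_neg_mul_mul hg y) hq

theorem differentiableAt_mellin_exp_neg_mul_mul {g : ℝ → ℂ} {b y : ℝ}
    (hg : ContinuousOn g (Ici 0)) (hgO : g =O[atTop] fun u => u ^ b) (hy : 0 < y) {q : ℂ}
    (hq : 0 < q.re) : DifferentiableAt ℂ (mellin fun u : ℝ => exp (-(y * u)) * g u) q :=
  mellin_differentiableAt_of_isBigO_rpow_exp (half_pos hy)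
    (locallyIntegrableOn_exp_neg_mul_mul hg y) (isBigO_exp_neg_mul_mul hy hgO)
    (isBigO_one_exp_neg_mul_mul hg y) hq

theorem continuousOn_one_add_mul_cpow {x : ℝ} (hx : 0 ≤ x) (a : ℂ) :
    ContinuousOn (fun u : ℝ => (1 + x * u : ℂ) ^ a) (Ici 0) := fun u hu => by
  refine (ContinuousAt.cpow (by fun_prop) continuousAt_const (Or.inl ?_)).continuousWithinAt
  rw [← ofReal_mul, add_re, one_re, ofReal_re]
  linarith [mul_nonneg hx hu]

theorem isBigO_one_add_mul_cpow {x : ℝ} (hx : 0 < x) (a : ℂ) :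
    (fun u : ℝ => (1 + x * u : ℂ) ^ a) =O[atTop] fun u => u ^ a.re := by
  have hΘ : (fun u : ℝ => 1 + x * u) =Θ[atTop] fun u => u := by
    refine ((Asymptotics.IsEquivalent.refl
      (u := fun u : ℝ => x * u)).const_add_of_norm_tendsto_atTop ?_).isTheta.trans
        ((Asymptotics.isTheta_const_mul_left hx.ne').2 (Asymptotics.isTheta_refl _ _))
    exact tendsto_norm_atTop_atTop.comp (tendsto_id.const_mul_atTop hx)
  have hpos : ∀ᶠ u : ℝ in atTop, 0 < 1 + x * u := by
    filter_upwards [eventually_ge_atTop 0] with u hu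
    positivity
  refine Asymptotics.IsBigO.trans (Asymptotics.IsBigO.of_norm_eventuallyLE ?_) (hΘ.rpow (r := a.re)
    (hpos.mono fun u hu => hu.le) (eventually_ge_atTop 0)).isBigO
  filter_upwards [hpos] with u hu
  rw [← norm_cpow_eq_rpow_re_of_pos hu]
  simp

/-- The weight whose Mellin transform is `q ↦ Γ(q) U(q, q + 1 - ν, y)`, with `U` Tricomi's confluent
hypergeometric function. -/
noncomputable def tricomiWeight (ν : ℂ) (y u : ℝ) : ℂ := exp (-(y * u)) * (1 + u : ℂ) ^ (-ν)

theorem continuousOn_one_add_cpow (a : ℂ) :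
    ContinuousOn (fun u : ℝ => (1 + u : ℂ) ^ a) (Ici 0) := by
  simpa using continuousOn_one_add_mul_cpow zero_le_one a

theorem isBigO_one_add_cpow (a : ℂ) :
    (fun u : ℝ => (1 + u : ℂ) ^ a) =O[atTop] fun u => u ^ a.re := by
  simpa using isBigO_one_add_mul_cpow one_pos a

theorem mellinConvergent_tricomiWeight (ν : ℂ) {y : ℝ} (hy : 0 < y) {q : ℂ} (hq : 0 < q.re) :
    MellinConvergent (tricomiWeight ν y) q :=
  mellinConvergent_exp_neg_mul_mul (continuousOn_one_add_cpow _) (isBigO_one_add_cpow _) hy hq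

theorem differentiableAt_mellin_tricomiWeight (ν : ℂ) {y : ℝ} (hy : 0 < y) {q : ℂ}
    (hq : 0 < q.re) : DifferentiableAt ℂ (mellin (tricomiWeight ν y)) q :=
  differentiableAt_mellin_exp_neg_mul_mul (continuousOn_one_add_cpow _) (isBigO_one_add_cpow _)
    hy hq

theorem mellinConvergent_one_add_mul_cpow_mul_tricomiWeight (ν : ℂ) {x y : ℝ} (hx : 0 < x)
    (hy : 0 < y) {q : ℂ} (hq : 0 < q.re) :
    MellinConvergent (fun u => (1 + x * u : ℂ) ^ ν * tricomiWeight ν y u) q := by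
  have hO : (fun u : ℝ => (1 + x * u : ℂ) ^ ν * (1 + u : ℂ) ^ (-ν)) =O[atTop]
      fun u => u ^ (ν.re + (-ν).re) := by
    refine ((isBigO_one_add_mul_cpow hx ν).mul (isBigO_one_add_cpow (-ν))).trans_eventuallyEq ?_
    filter_upwards [eventually_gt_atTop 0] with u hu using (Real.rpow_add hu _ _).symm
  simpa only [tricomiWeight, mul_left_comm] using mellinConvergent_exp_neg_mul_mul
    ((continuousOn_one_add_mul_cpow hx.le ν).fun_mul (continuousOn_one_add_cpow (-ν))) hO hy hq

theorem verticalIntegrable_Gamma_mul_Gamma_sub_mul_Gamma {ν q : ℂ} {c : ℝ} (hc : 0 < c)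
    (hcq : c < q.re) (hqν : q.re - ν.re < c) :
    VerticalIntegrable (fun t => Gamma t * (Gamma (q - t) * Gamma (ν - (q - t)))) c := by
  have hintg := (verticalIntegrable_mul_mellin_sub (q := q)
    (verticalIntegrable_Gamma (c := c) fun k hk => by linarith [k.cast_nonneg (α := ℝ)])
    (mellinConvergent_one_add_cpow_neg (a := ν) (by simpa using hcq)
      (by simp only [sub_re, ofReal_re]; linarith))).const_mul (Gamma ν)
  refine hintg.congr (ae_of_all _ fun v => ?_)
  beta_reduce
  rw [mul_left_comm, Gamma_mul_mellin_one_add_cpow_neg (by simpa using hcq) (by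
    simp only [sub_re, add_re, ofReal_re, mul_re, I_re, I_im, ofReal_im]; linarith)]

theorem mellinInv_Gamma_mul_Gamma_sub_mul_Gamma {ν q : ℂ} {c y : ℝ} (hc : 0 < c)
    (hcq : c < q.re) (hqν : q.re - ν.re < c) (hy : 0 < y) :
    mellinInv c (fun t => Gamma t * (Gamma (q - t) * Gamma (ν - (q - t)))) y =
      Gamma ν * mellin (tricomiWeight ν y) q := by
  have hconv : MellinConvergent (fun u => (1 + u : ℂ) ^ (-ν)) (q - c) :=
    mellinConvergent_one_add_cpow_neg (by simpa using hcq)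
      (by simp only [sub_re, ofReal_re]; linarith)
  have hΓ : VerticalIntegrable Gamma c :=
    verticalIntegrable_Gamma fun k hk => by linarith [k.cast_nonneg (α := ℝ)]
  have hbeta (t : ℂ) (ht : t.re = c) : Gamma t * (Gamma (q - t) * Gamma (ν - (q - t))) =
      Gamma t * mellin (fun u => Gamma ν • (1 + u : ℂ) ^ (-ν)) (q - t) := by
    rw [← Gamma_mul_mellin_one_add_cpow_neg (by simpa [ht] using hcq) (by
      rw [sub_re, ht]; linarith)]
    exact congrArg (Gamma t * ·) (mellin_const_smul _ (q - t) (Gamma ν)).symm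
  rw [mellinInv_congr hbeta, mellinInv_mul_mellin_sub hΓ (hconv.const_smul (Gamma ν)) hy,
    ← smul_eq_mul (Gamma ν), ← mellin_const_smul]
  refine setIntegral_congr_fun measurableSet_Ioi fun u hu => ?_
  simp only [mellinInv_Gamma hc (mul_pos hy hu), tricomiWeight, smul_eq_mul, ofReal_mul]
  ring

theorem verticalIntegrable_Gamma_mul_Gamma_neg_sub {ν : ℂ} {n : ℕ} {σ : ℝ} (hσ : 0 < σ)
    (hn : n - 1 < ν.re + σ) (hn' : ν.re + σ < n) :
    VerticalIntegrable (fun s => Gamma s * Gamma (-ν - s)) σ := by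
  refine verticalIntegrable_Gamma_mul_Gamma_sub (fun k hk => ?_) fun k hk => ?_
  · linarith [k.cast_nonneg (α := ℝ)]
  · rw [neg_re] at hk
    have h1 : (k : ℝ) < n := by linarith
    have h2 : (n : ℝ) < k + 1 := by linarith
    norm_cast at h1 h2
    lia

theorem mellinInv_Gamma_mul_Gamma_neg_sub_mul_mellin {ν α : ℂ} {n : ℕ} {σ x : ℝ} {h : ℝ → ℂ}
    (hν : ∀ k : ℕ, ν ≠ k) (hσ : 0 < σ) (hn : n - 1 < ν.re + σ) (hn' : ν.re + σ < n) (hx : 0 < x)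
    (hh : MellinConvergent h (α - σ))
    (hhν : MellinConvergent (fun u => (1 + x * u : ℂ) ^ ν * h u) α)
    (hhk : ∀ k < n, MellinConvergent h (α + (ν - k))) :
    mellinInv σ (fun s => Gamma s * Gamma (-ν - s) * mellin h (α - s)) x =
      Gamma (-ν) * mellin (fun u => (1 + x * u : ℂ) ^ ν * h u) α -
        ∑ k ∈ Finset.range n, (-1) ^ k / k.factorial * Gamma (k - ν) * (x : ℂ) ^ (ν - k) *
          mellin h (α + (ν - k)) := by
  have hconv (k : ℕ) (hk : k ∈ Finset.range n) :=
    MellinConvergent.cpow_smul.2 (hhk k (Finset.mem_range.1 hk))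
  set C : ℕ → ℂ := fun k => (-1) ^ k / k.factorial * Gamma (k - ν) * (x : ℂ) ^ (ν - k) with hC
  calc mellinInv σ (fun s => Gamma s * Gamma (-ν - s) * mellin h (α - s)) x
      = ∫ u in Ioi (0 : ℝ), (Gamma (-ν) * ((u : ℂ) ^ (α - 1) • ((1 + x * u : ℂ) ^ ν * h u)) -
          ∑ k ∈ Finset.range n, C k * ((u : ℂ) ^ (α - 1) • ((u : ℂ) ^ (ν - k) • h u))) := by
        rw [mellinInv_mul_mellin_sub (verticalIntegrable_Gamma_mul_Gamma_neg_sub hσ hn hn') hh hx]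
        refine setIntegral_congr_fun measurableSet_Ioi fun u hu => ?_
        simp only [mellinInv_Gamma_mul_Gamma_neg_sub hν hσ hn hn' (mul_pos hx hu), ofReal_mul,
          mul_cpow_ofReal_nonneg hx.le (mem_Ioi.1 hu).le, smul_eq_mul, sub_mul, mul_sub,
          Finset.sum_mul, Finset.mul_sum, hC]
        congr 1
        · ring
        · exact Finset.sum_congr rfl fun k _ => by ring
    _ = Gamma (-ν) * mellin (fun u => (1 + x * u : ℂ) ^ ν * h u) α -
          ∑ k ∈ Finset.range n, C k * mellin h (α + (ν - k)) := by
        rw [integral_sub (hhν.const_mul _) (integrable_finsetSum _ fun k hk =>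
          (hconv k hk).const_mul _), integral_const_mul, integral_finsetSum _ fun k hk =>
          (hconv k hk).const_mul _]
        simp only [integral_const_mul, ← mellin_cpow_smul]
        rfl

/-! ### Residues of the Gamma function -/

theorem circleIntegral_eq_of_tendsto_sub_mul {c y : ℂ} {r : ℝ} (hr : 0 < r) {f : ℂ → ℂ}
    (hf : DifferentiableOn ℂ f (Metric.closedBall c r \ {c}))
    (hy : Tendsto (fun s => (s - c) * f s) (𝓝[≠] c) (𝓝 y)) :
    circleIntegral f c r = 2 * π * I * y := by
  have hg : DifferentiableOn ℂ (fun s => (s - c) * f s) (Metric.closedBall c r \ {c}) :=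
    (differentiableOn_id.sub_const c).mul hf
  rw [← smul_eq_mul (2 * π * I),
    ← circleIntegral_sub_center_inv_smul_of_differentiable_on_off_countable_of_tendsto hr
      countable_empty hg.continuousOn ?_ hy]
  · refine circleIntegral.integral_congr hr.le fun s hs => ?_
    have hs0 : s - c ≠ 0 := sub_ne_zero.2 (Metric.ne_of_mem_sphere hs hr.ne')
    simp only [smul_eq_mul, inv_mul_cancel_left₀ hs0]
  · rintro s ⟨⟨hs, hsc⟩, -⟩
    exact hg.differentiableAt (mem_of_superset
      ((Metric.isOpen_ball.sdiff isClosed_singleton).mem_nhds ⟨hs, hsc⟩)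
      (sdiff_subset_sdiff_left Metric.ball_subset_closedBall))

theorem tendsto_add_mul_Gamma_nhds_neg_nat (k : ℕ) :
    Tendsto (fun z : ℂ => (z + k) * Gamma z) (𝓝[≠] (-k)) (𝓝 ((-1) ^ k / k.factorial)) := by
  induction k with
  | zero => simpa using tendsto_self_mul_Gamma_nhds_zero
  | succ k ih =>
    have hshift : Tendsto (fun z : ℂ => z + 1) (𝓝[≠] (-(k + 1 : ℕ))) (𝓝[≠] (-k)) := by
      refine tendsto_nhdsWithin_iff.2 ⟨tendsto_nhdsWithin_of_tendsto_nhds ?_, ?_⟩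
      · exact (continuous_add_const (1 : ℂ)).tendsto' _ _ (by push_cast; ring)
      · filter_upwards [self_mem_nhdsWithin] with z hz h
        exact hz (mem_singleton_iff.2 (by push_cast; linear_combination mem_singleton_iff.1 h))
    have hid : Tendsto (fun z : ℂ => z) (𝓝[≠] (-(k + 1 : ℕ))) (𝓝 (-(k + 1 : ℕ))) :=
      tendsto_nhdsWithin_of_tendsto_nhds tendsto_id
    have hne : (-(k + 1 : ℕ) : ℂ) ≠ 0 := neg_ne_zero.2 (Nat.cast_ne_zero.2 k.succ_ne_zero)
    convert ((ih.comp hshift).div hid hne).congr' ?_ using 2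
    · rw [Nat.factorial_succ, pow_succ]
      push_cast
      field_simp
    · filter_upwards [hid.eventually_ne hne] with z hz
      simp only [Pi.div_apply, Function.comp_apply, Gamma_add_one z hz]
      push_cast
      field_simp
      ring

section

variable {a : ℂ} {k : ℕ} {r : ℝ} {φ : ℂ → ℂ}

theorem differentiableOn_Gamma_sub_mul (hr : r < 1)
    (hφ : DifferentiableOn ℂ φ (Metric.closedBall (a + k) r)) :
    DifferentiableOn ℂ (fun s => Gamma (a - s) * φ s)
      (Metric.closedBall (a + k) r \ {a + (k : ℂ)}) := by
  refine DifferentiableOn.mul (fun s hs => ?_) (hφ.mono sdiff_subset)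
  refine ((differentiableAt_Gamma _ fun m hm => hs.2 ?_).comp s
    (differentiableAt_id.const_sub a)).differentiableWithinAt
  have hsm : s = a + (m : ℂ) := by simp only [id_eq] at hm; linear_combination -hm
  have hmk : |(m - k : ℤ)| < 1 := by
    have h := (Metric.mem_closedBall.1 hs.1).trans_lt hr
    rw [hsm, dist_add_left, dist_eq_norm] at h
    have h' : ‖((m - k : ℤ) : ℂ)‖ < 1 := by exact_mod_cast h
    rw [norm_intCast] at h'
    exact_mod_cast h'
  obtain rfl : m = k := by rw [abs_lt] at hmk; omega
  exact hsm

theorem circleIntegrable_Gamma_sub_mul (hr : 0 < r) (hr1 : r < 1)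
    (hφ : DifferentiableOn ℂ φ (Metric.closedBall (a + k) r)) :
    CircleIntegrable (fun s => Gamma (a - s) * φ s) (a + k) r :=
  ((differentiableOn_Gamma_sub_mul hr1 hφ).continuousOn.mono fun _ hs =>
    ⟨Metric.sphere_subset_closedBall hs, Metric.ne_of_mem_sphere hs hr.ne'⟩).circleIntegrable hr.le

theorem circleIntegral_Gamma_sub_mul (hr : 0 < r) (hr1 : r < 1)
    (hφ : DifferentiableOn ℂ φ (Metric.closedBall (a + k) r)) :
    circleIntegral (fun s => Gamma (a - s) * φ s) (a + k) r =
      -(2 * π * I) * ((-1) ^ k / k.factorial * φ (a + k)) := by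
  have hflip : Tendsto (fun s => a - s) (𝓝[≠] (a + k)) (𝓝[≠] (-k)) := by
    refine tendsto_nhdsWithin_iff.2 ⟨tendsto_nhdsWithin_of_tendsto_nhds ?_, ?_⟩
    · exact (continuous_const.sub continuous_id).tendsto' _ _ (by simp)
    · filter_upwards [self_mem_nhdsWithin] with s hs h
      exact hs (mem_singleton_iff.2 (by linear_combination -mem_singleton_iff.1 h))
  have hφc : Tendsto φ (𝓝[≠] (a + k)) (𝓝 (φ (a + k))) :=
    tendsto_nhdsWithin_of_tendsto_nhds
      (hφ.continuousOn.continuousAt (Metric.closedBall_mem_nhds _ hr))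
  have hres := (((tendsto_add_mul_Gamma_nhds_neg_nat k).comp hflip).mul hφc).neg
  rw [circleIntegral_eq_of_tendsto_sub_mul hr (differentiableOn_Gamma_sub_mul hr1 hφ)
    (hres.congr fun s => ?_)]
  · ring
  · simp only [Function.comp_apply]
    ring

end

/-! ### Contours separating two families of poles -/

section

variable {A B : Set ℂ} {f g : ℂ → ℂ}

theorem sepAbscissa_mem_Ioo {a b : ℝ} (hA : IsGreatest (re '' A) a)
    (hab : a < b) (hb : ∃ q ∈ B, q.re = b) (hB : ∀ q ∈ B, a < q.re → b ≤ q.re) :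
    sepAbscissa A B ∈ Ioo a b := by
  obtain ⟨q, hq, hqb⟩ := hb
  have hlow : ∀ x ∈ insert (a + 2) {x | a < x ∧ ∃ q ∈ B, q.re = x}, min (a + 2) b ≤ x := by
    rintro x (rfl | ⟨hx, p, hp, rfl⟩)
    · exact min_le_left _ _
    · exact (min_le_right _ _).trans (hB p hp hx)
  have hmin : min (a + 2) b ≤ sInf (insert (a + 2) {x | a < x ∧ ∃ q ∈ B, q.re = x}) :=
    le_csInf ⟨_, mem_insert _ _⟩ hlow
  have hle : sInf (insert (a + 2) {x | a < x ∧ ∃ q ∈ B, q.re = x}) ≤ b :=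
    csInf_le ⟨_, hlow⟩ (mem_insert_of_mem _ ⟨hab, q, hq, hqb⟩)
  have ha : a < min (a + 2) b := lt_min (by linarith) hab
  rw [sepAbscissa, hA.csSup_eq]
  constructor <;> linarith

theorem two_mul_sepRadius_le {ρ : ℝ}
    (hρ : ρ ∈ insert 1 {ρ | ∃ p ∈ A ∪ B, ∃ q ∈ A ∪ B, p ≠ q ∧ ρ = dist p q}) :
    2 * sepRadius A B ≤ ρ := by
  rw [sepRadius, mul_div_cancel₀ _ two_ne_zero]
  refine csInf_le ⟨0, ?_⟩ hρ
  rintro x (rfl | ⟨p, -, q, -, -, rfl⟩)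
  · exact zero_le_one
  · exact dist_nonneg

theorem sepRadius_le_half (A B : Set ℂ) : sepRadius A B ≤ 1 / 2 := by
  linarith [two_mul_sepRadius_le (A := A) (B := B) (mem_insert _ _)]

theorem sepRadius_nonneg (A B : Set ℂ) : 0 ≤ sepRadius A B := by
  refine div_nonneg (Real.sInf_nonneg ?_) zero_le_two
  rintro x (rfl | ⟨p, -, q, -, -, rfl⟩)
  · exact zero_le_one
  · exact dist_nonneg

theorem notMem_of_mem_closedBall_sepRadius (hr : 0 < sepRadius A B) (hAB : Disjoint A B) {p s : ℂ}
    (hp : p ∈ B) (hs : s ∈ Metric.closedBall p (sepRadius A B)) : s ∉ A := fun hsA => by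
  have := two_mul_sepRadius_le (mem_insert_of_mem _
    ⟨s, Or.inl hsA, p, Or.inr hp, fun h => disjoint_left.1 hAB hsA (h ▸ hp), rfl⟩)
  linarith [Metric.mem_closedBall.1 hs]

theorem exists_pos_le_norm_add_intCast {S : Set ℂ} (hS : S.Finite) :
    ∃ ε > 0, ∀ d ∈ S, ∀ m : ℤ, d + m ≠ 0 → ε ≤ ‖d + m‖ := by
  set D : Set ℂ := ⋃ d ∈ S, (fun m : ℤ => d + (m : ℂ)) '' {m | d + (m : ℂ) ≠ 0} with hD
  have hclosed : IsClosed D := hS.isClosed_biUnion fun d _ =>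
    ((Homeomorph.addLeft d).isClosedEmbedding.comp isClosedEmbedding_intCast).isClosedMap _
      (isClosed_discrete _)
  have hzero : (0 : ℂ) ∈ Dᶜ := by
    simp only [hD, mem_compl_iff, mem_iUnion, mem_image, not_exists]
    rintro d - m ⟨hm, hm0⟩
    exact hm hm0
  obtain ⟨ε, hε, hball⟩ := Metric.isOpen_iff.1 hclosed.isOpen_compl 0 hzero
  exact ⟨ε, hε, fun d hd m hm => not_lt.1 fun hlt =>
    hball (mem_ball_zero_iff.2 hlt) (mem_biUnion hd ⟨m, hm, rfl⟩)⟩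

theorem sepRadius_leftPoles_rightPoles_pos (hs ks : List ℂ) :
    0 < sepRadius (leftPoles hs) (rightPoles ks) := by
  have hfin : {h | h ∈ hs ++ ks}.Finite := List.finite_toSet _
  obtain ⟨ε, hε, hle⟩ := exists_pos_le_norm_add_intCast (hfin.image2 (· - ·) hfin)
  have hpole : ∀ p ∈ leftPoles hs ∪ rightPoles ks, ∃ h ∈ hs ++ ks, ∃ m : ℤ, p = h + m := by
    rintro p (⟨h, hh, k, rfl⟩ | ⟨h, hh, k, rfl⟩)
    · exact ⟨h, List.mem_append_left _ hh, -k, by push_cast; ring⟩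
    · exact ⟨h, List.mem_append_right _ hh, k, by push_cast; ring⟩
  refine half_pos ((lt_min one_pos hε).trans_le (le_csInf ⟨_, mem_insert _ _⟩ ?_))
  rintro x (rfl | ⟨p, hp, q, hq, hpq, rfl⟩)
  · exact min_le_left _ _
  obtain ⟨h, hh, m, rfl⟩ := hpole p hp
  obtain ⟨h', hh', m', rfl⟩ := hpole q hq
  have hdiff : h + m - (h' + m') = h - h' + (m - m' : ℤ) := by push_cast; ring
  rw [dist_eq_norm, hdiff]
  exact (min_le_right _ _).trans
    (hle _ (mem_image2_of_mem hh hh') _ (hdiff ▸ sub_ne_zero.2 hpq))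

theorem disjoint_leftPoles_rightPoles {hs ks : List ℂ}
    (h : ∀ a ∈ hs, ∀ b ∈ ks, ∀ k : ℕ, b + k ≠ a) : Disjoint (leftPoles hs) (rightPoles ks) := by
  rw [disjoint_left]
  rintro _ ⟨a, ha, i, rfl⟩ ⟨b, hb, j, hij⟩
  exact h a ha b hb (i + j) (by push_cast; linear_combination -hij)

theorem mellinBarnes_congr (hfg : EqOn f g (mellinBarnesContour A B)) :
    mellinBarnes A B f = mellinBarnes A B g := by
  have hline (v : ℝ) : f (sepAbscissa A B + v * I) = g (sepAbscissa A B + v * I) :=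
    hfg (Or.inl (by simp))
  have hcircle : ∀ p ∈ misplaced A B,
      circleIntegral f p (sepRadius A B) = circleIntegral g p (sepRadius A B) := fun p hp =>
    circleIntegral.integral_congr (sepRadius_nonneg A B) fun s hs =>
      hfg (Or.inr (mem_biUnion hp hs))
  simp only [mellinBarnes, hline, finsum_mem_congr rfl hcircle]

theorem MellinBarnesConverges.congr (hf : MellinBarnesConverges A B f)
    (hfg : EqOn f g (mellinBarnesContour A B)) : MellinBarnesConverges A B g := by
  refine ⟨hf.1, hf.2.1.congr (ae_of_all _ fun v => hfg (Or.inl (by simp))), fun p hp => ?_⟩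
  refine (circleIntegrable_congr fun s hs => hfg (Or.inr (mem_biUnion hp ?_))).1 (hf.2.2 p hp)
  rwa [abs_of_nonneg (sepRadius_nonneg A B)] at hs

theorem mellinBarnes_mul_const (f : ℂ → ℂ) (z : ℂ) :
    mellinBarnes A B (fun s => f s * z) = mellinBarnes A B f * z := by
  have hcircle (p : ℂ) :
      circleIntegral (fun s => f s * z) p (sepRadius A B) =
        circleIntegral f p (sepRadius A B) * z :=
    circleIntegral.integral_smul_const f z p _
  rw [mellinBarnes, mellinBarnes, integral_mul_const]
  simp only [hcircle, ← finsum_mem_mul]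
  ring

theorem MellinBarnesConverges.mul_const (hf : MellinBarnesConverges A B f) (z : ℂ) :
    MellinBarnesConverges A B (fun s => f s * z) :=
  ⟨hf.1, hf.2.1.mul_const z, fun p hp =>
    (hf.2.2 p hp).smul_continuousOn (continuousOn_const (c := z))⟩

theorem mellinBarnes_cpow_neg_mul (φ : ℂ → ℂ) (x : ℝ) :
    mellinBarnes A B (fun s => (x : ℂ) ^ (-s) * φ s) = mellinInv (sepAbscissa A B) φ x -
      (2 * π * I)⁻¹ * ∑ᶠ (p : ℂ) (_ : p ∈ misplaced A B),
        circleIntegral (fun s => (x : ℂ) ^ (-s) * φ s) p (sepRadius A B) := by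
  rw [mellinBarnes, mellinInv, mul_sub, real_smul, ← mul_assoc, mul_right_comm]
  simp only [smul_eq_mul]
  congr 2
  push_cast
  field_simp

end

/-! ### The inner integral -/

section

variable {ν q : ℂ}

theorem sepAbscissa_inner_mem_Ioo (hν : 0 < ν.re) (hq : 0 < q.re) :
    sepAbscissa (leftPoles [q - ν, 0]) (rightPoles [q]) ∈ Ioo (max (q.re - ν.re) 0) q.re := by
  refine sepAbscissa_mem_Ioo ⟨?_, ?_⟩ (max_lt (by linarith) hq)
    ⟨q, ⟨q, by simp, 0, by simp⟩, rfl⟩ ?_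
  · rcases max_choice (q.re - ν.re) 0 with h | h <;> rw [h]
    · exact ⟨q - ν, ⟨q - ν, by simp, 0, by simp⟩, by simp⟩
    · exact ⟨0, ⟨0, by simp, 0, by simp⟩, by simp⟩
  · rintro _ ⟨p, ⟨h, hh, k, rfl⟩, rfl⟩
    simp only [List.mem_cons, List.not_mem_nil, or_false] at hh
    rcases hh with rfl | rfl
    · exact le_max_of_le_left (by simp)
    · exact le_max_of_le_right (by simp)
  · rintro _ ⟨h, hh, k, rfl⟩ -
    obtain rfl : h = q := by simpa using hh
    simp

theorem misplaced_inner (hν : 0 < ν.re) (hq : 0 < q.re) :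
    misplaced (leftPoles [q - ν, 0]) (rightPoles [q]) = ∅ := by
  refine eq_empty_of_forall_notMem ?_
  rintro _ ⟨⟨h, hh, k, rfl⟩, hlt⟩
  obtain rfl : h = q := by simpa using hh
  have hσ := (sepAbscissa_inner_mem_Ioo hν hq).2
  simp only [add_re, natCast_re] at hlt
  linarith [k.cast_nonneg (α := ℝ)]

theorem mellinBarnesConverges_inner (hν : 0 < ν.re) (hq : 0 < q.re) {y : ℝ} (hy : 0 < y) :
    MellinBarnesConverges (leftPoles [q - ν, 0]) (rightPoles [q])
      (fun t => (y : ℂ) ^ (-t) * (Gamma t * (Gamma (q - t) * Gamma (ν - (q - t))))) := by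
  obtain ⟨hσ, hσq⟩ := sepAbscissa_inner_mem_Ioo hν hq
  obtain ⟨hσν, hσ0⟩ := max_lt_iff.1 hσ
  refine ⟨disjoint_leftPoles_rightPoles fun a ha b hb k h => ?_,
    verticalIntegrable_cpow_neg_mul
      (verticalIntegrable_Gamma_mul_Gamma_sub_mul_Gamma hσ0 hσq hσν) hy,
    by simp [misplaced_inner hν hq]⟩
  obtain rfl : b = q := by simpa using hb
  have hre := congrArg re h
  simp only [List.mem_cons, List.not_mem_nil, or_false] at ha
  rcases ha with rfl | rfl <;> simp at hre <;> linarith [k.cast_nonneg (α := ℝ)]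

theorem mellinBarnes_inner (hν : 0 < ν.re) (hq : 0 < q.re) {y : ℝ} (hy : 0 < y) :
    mellinBarnes (leftPoles [q - ν, 0]) (rightPoles [q])
        (fun t => (y : ℂ) ^ (-t) * (Gamma t * (Gamma (q - t) * Gamma (ν - (q - t))))) =
      Gamma ν * mellin (tricomiWeight ν y) q := by
  obtain ⟨hσ, hσq⟩ := sepAbscissa_inner_mem_Ioo hν hq
  obtain ⟨hσν, hσ0⟩ := max_lt_iff.1 hσ
  rw [mellinBarnes_cpow_neg_mul, misplaced_inner hν hq,
    mellinInv_Gamma_mul_Gamma_sub_mul_Gamma hσ0 hσq hσν hy]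
  simp

end

/-! ### The outer integral -/

section

variable {ν α : ℂ}

theorem sepAbscissa_outer_mem_Ioo (hν : 0 ≤ ν.re) (hα : 1 ≤ α.re) :
    sepAbscissa (leftPoles [0]) (rightPoles [-ν, α]) ∈ Ioo 0 ((⌊ν.re⌋₊ + 1 : ℕ) - ν.re) := by
  have hlt := Nat.lt_floor_add_one ν.re
  have hle := Nat.floor_le hν
  refine sepAbscissa_mem_Ioo ⟨⟨0, ⟨0, by simp, 0, by simp⟩, by simp⟩, ?_⟩
    (by push_cast; linarith)
    ⟨-ν + (⌊ν.re⌋₊ + 1 : ℕ), ⟨-ν, by simp, _, rfl⟩, by simp; ring⟩ ?_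
  · rintro _ ⟨p, ⟨h, hh, k, rfl⟩, rfl⟩
    obtain rfl : h = 0 := by simpa using hh
    simp
  · rintro _ ⟨h, hh, k, rfl⟩ hpos
    simp only [List.mem_cons, List.not_mem_nil, or_false] at hh
    rcases hh with rfl | rfl
    · simp only [add_re, neg_re, natCast_re] at hpos ⊢
      have hk : ((⌊ν.re⌋₊ + 1 : ℕ) : ℝ) ≤ k :=
        Nat.cast_le.2 ((Nat.floor_lt hν).2 (by linarith))
      linarith
    · simp only [add_re, natCast_re] at hpos ⊢
      push_cast
      linarith [k.cast_nonneg (α := ℝ)]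

theorem misplaced_outer (hν : 0 ≤ ν.re) (hα : 1 ≤ α.re) :
    misplaced (leftPoles [0]) (rightPoles [-ν, α]) =
      (fun k : ℕ => -ν + (k : ℂ)) '' Finset.range (⌊ν.re⌋₊ + 1) := by
  have hle := Nat.floor_le hν
  obtain ⟨hσ0, hσ⟩ := sepAbscissa_outer_mem_Ioo hν hα
  ext p
  constructor
  · rintro ⟨⟨h, hh, k, rfl⟩, hlt⟩
    simp only [List.mem_cons, List.not_mem_nil, or_false] at hh
    rcases hh with rfl | rfl
    · simp only [add_re, neg_re, natCast_re] at hlt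
      have hk : (k : ℝ) < (⌊ν.re⌋₊ + 1 : ℕ) := by linarith
      exact ⟨k, Finset.mem_coe.2 (Finset.mem_range.2 (Nat.cast_lt.1 hk)), rfl⟩
    · simp only [add_re, natCast_re] at hlt
      push_cast at hσ
      linarith [k.cast_nonneg (α := ℝ)]
  · rintro ⟨k, hk, rfl⟩
    have hk' : (k : ℝ) ≤ ⌊ν.re⌋₊ :=
      Nat.cast_le.2 (Nat.lt_succ_iff.1 (Finset.mem_range.1 (Finset.mem_coe.1 hk)))
    refine ⟨⟨-ν, by simp, k, rfl⟩, ?_⟩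
    simp only [add_re, neg_re, natCast_re]
    linarith

theorem re_lt_of_mem_closedBall_outer (hν : 0 ≤ ν.re) (hα : 1 ≤ α.re) {p s : ℂ}
    (hp : p ∈ misplaced (leftPoles [0]) (rightPoles [-ν, α]))
    (hs : s ∈ Metric.closedBall p (sepRadius (leftPoles [0]) (rightPoles [-ν, α]))) :
    s.re < α.re := by
  rw [misplaced_outer hν hα] at hp
  obtain ⟨k, hk, rfl⟩ := hp
  have hk' : (k : ℝ) ≤ ⌊ν.re⌋₊ :=
    Nat.cast_le.2 (Nat.lt_succ_iff.1 (Finset.mem_range.1 (Finset.mem_coe.1 hk)))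
  have hle := Nat.floor_le hν
  have hre := (re_le_norm _).trans
    ((mem_closedBall_iff_norm.1 hs).trans (sepRadius_le_half _ _))
  simp only [sub_re, add_re, neg_re, natCast_re] at hre
  linarith

theorem sepAbscissa_outer_lt (hν : 0 ≤ ν.re) (hα : 1 ≤ α.re) :
    sepAbscissa (leftPoles [0]) (rightPoles [-ν, α]) < α.re := by
  have hσ := (sepAbscissa_outer_mem_Ioo hν hα).2
  have hle := Nat.floor_le hν
  push_cast at hσ
  linarith

theorem re_lt_of_mem_mellinBarnesContour_outer (hν : 0 ≤ ν.re) (hα : 1 ≤ α.re) {s : ℂ}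
    (hs : s ∈ mellinBarnesContour (leftPoles [0]) (rightPoles [-ν, α])) : s.re < α.re := by
  rcases hs with hs | hs
  · exact Eq.trans_lt hs (sepAbscissa_outer_lt hν hα)
  · obtain ⟨p, hp, hs⟩ := mem_iUnion₂.1 hs
    exact re_lt_of_mem_closedBall_outer hν hα hp (Metric.sphere_subset_closedBall hs)

theorem disjoint_outer (hν : ∀ k : ℕ, ν ≠ k) (hα : 0 < α.re) :
    Disjoint (leftPoles [0]) (rightPoles [-ν, α]) := by
  refine disjoint_leftPoles_rightPoles fun a ha b hb k h => ?_
  obtain rfl : a = 0 := by simpa using ha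
  simp only [List.mem_cons, List.not_mem_nil, or_false] at hb
  rcases hb with rfl | rfl
  · exact hν k (by linear_combination -h)
  · have hre := congrArg re h
    simp only [add_re, natCast_re, zero_re] at hre
    linarith [k.cast_nonneg (α := ℝ)]

end

section

variable {ν α : ℂ} {x y : ℝ}

theorem differentiableOn_outer (hν : ∀ k : ℕ, ν ≠ k) (hν0 : 0 ≤ ν.re) (hα : 1 ≤ α.re)
    (hx : 0 < x) (hy : 0 < y) {p : ℂ} (hp : p ∈ misplaced (leftPoles [0]) (rightPoles [-ν, α])) :
    DifferentiableOn ℂ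
      (fun s => (x : ℂ) ^ (-s) * (Gamma s * mellin (tricomiWeight ν y) (α - s)))
      (Metric.closedBall p (sepRadius (leftPoles [0]) (rightPoles [-ν, α]))) := by
  intro s hs
  have hΓ : DifferentiableAt ℂ Gamma s := differentiableAt_Gamma s fun m hm =>
    notMem_of_mem_closedBall_sepRadius (sepRadius_leftPoles_rightPoles_pos _ _)
      (disjoint_outer hν (one_pos.trans_le hα)) hp.1 hs ⟨0, by simp, m, by simpa using hm⟩
  have hmellin : DifferentiableAt ℂ (mellin (tricomiWeight ν y)) (α - s) :=
    differentiableAt_mellin_tricomiWeight ν hy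
      (by simpa using re_lt_of_mem_closedBall_outer hν0 hα hp hs)
  have hpow : DifferentiableAt ℂ (fun s => (x : ℂ) ^ (-s)) s :=
    differentiableAt_id.neg.const_cpow (Or.inl (ofReal_ne_zero.2 hx.ne'))
  exact (hpow.mul (hΓ.mul
    (hmellin.comp s (differentiableAt_id.const_sub α)))).differentiableWithinAt

theorem mellinBarnesConverges_outer (hν : ∀ k : ℕ, ν ≠ k) (hν0 : 0 ≤ ν.re) (hα : 1 ≤ α.re)
    (hx : 0 < x) (hy : 0 < y) :
    MellinBarnesConverges (leftPoles [0]) (rightPoles [-ν, α])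
      (fun s => (x : ℂ) ^ (-s) *
        (Gamma s * Gamma (-ν - s) * mellin (tricomiWeight ν y) (α - s))) := by
  obtain ⟨hσ0, hσ⟩ := sepAbscissa_outer_mem_Ioo hν0 hα
  have hlt := sepAbscissa_outer_lt hν0 hα
  refine ⟨disjoint_outer hν (one_pos.trans_le hα), ?_, fun p hp => ?_⟩
  · refine verticalIntegrable_cpow_neg_mul (verticalIntegrable_mul_mellin_sub
      (verticalIntegrable_Gamma_mul_Gamma_neg_sub (n := ⌊ν.re⌋₊ + 1) hσ0 ?_ (by linarith))
      (mellinConvergent_tricomiWeight ν hy (by simpa using hlt))) hx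
    push_cast
    linarith [Nat.floor_le hν0]
  · have hd := differentiableOn_outer hν hν0 hα hx hy hp
    rw [misplaced_outer hν0 hα] at hp
    obtain ⟨k, -, rfl⟩ := hp
    refine (circleIntegrable_congr fun s _ => ?_).1 (circleIntegrable_Gamma_sub_mul
      (sepRadius_leftPoles_rightPoles_pos _ _)
      ((sepRadius_le_half _ _).trans_lt (by norm_num)) hd)
    ring

theorem circleIntegral_outer (hν : ∀ k : ℕ, ν ≠ k) (hν0 : 0 ≤ ν.re) (hα : 1 ≤ α.re)
    (hx : 0 < x) (hy : 0 < y) {k : ℕ} (hk : k ∈ Finset.range (⌊ν.re⌋₊ + 1)) :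
    circleIntegral (fun s => (x : ℂ) ^ (-s) *
        (Gamma s * Gamma (-ν - s) * mellin (tricomiWeight ν y) (α - s))) (-ν + k)
        (sepRadius (leftPoles [0]) (rightPoles [-ν, α])) =
      -(2 * π * I) * ((-1) ^ k / k.factorial * Gamma (k - ν) * (x : ℂ) ^ (ν - k) *
        mellin (tricomiWeight ν y) (α + (ν - k))) := by
  have hp : -ν + (k : ℂ) ∈ misplaced (leftPoles [0]) (rightPoles [-ν, α]) := by
    rw [misplaced_outer hν0 hα]
    exact mem_image_of_mem _ (Finset.mem_coe.2 hk)
  have h := circleIntegral_Gamma_sub_mul (sepRadius_leftPoles_rightPoles_pos _ _)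
    ((sepRadius_le_half _ _).trans_lt (by norm_num)) (differentiableOn_outer hν hν0 hα hx hy hp)
  rw [show α + (ν - k) = α - (-ν + k) by ring, show ν - (k : ℂ) = -(-ν + k) by ring,
    show (k : ℂ) - ν = -ν + k by ring]
  convert h using 1
  · congr 1 with s
    ring
  · ring

/-- The residues at the misplaced poles cancel the Taylor polynomial that the Mellin inversion along
the vertical line subtracts from `(1 + x * u) ^ ν`. -/
theorem mellinBarnes_outer (hν : ∀ k : ℕ, ν ≠ k) (hν0 : 0 ≤ ν.re) (hα : 1 ≤ α.re)
    (hx : 0 < x) (hy : 0 < y) :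
    mellinBarnes (leftPoles [0]) (rightPoles [-ν, α])
        (fun s => (x : ℂ) ^ (-s) *
          (Gamma s * Gamma (-ν - s) * mellin (tricomiWeight ν y) (α - s))) =
      Gamma (-ν) * mellin (fun u => (1 + x * u : ℂ) ^ ν * tricomiWeight ν y u) α := by
  obtain ⟨hσ0, hσ⟩ := sepAbscissa_outer_mem_Ioo hν0 hα
  have hlt := sepAbscissa_outer_lt hν0 hα
  have hfloor := Nat.floor_le hν0
  rw [mellinBarnes_cpow_neg_mul, misplaced_outer hν0 hα,
    mellinInv_Gamma_mul_Gamma_neg_sub_mul_mellin (n := ⌊ν.re⌋₊ + 1) hν hσ0 (by push_cast; linarith)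
      (by linarith) hx (mellinConvergent_tricomiWeight ν hy (by simpa using hlt))
      (mellinConvergent_one_add_mul_cpow_mul_tricomiWeight ν hx hy (one_pos.trans_le hα)) ?_,
    finsum_mem_image fun i _ j _ h => Nat.cast_injective (add_left_cancel h),
    finsum_mem_coe_finset, Finset.sum_congr rfl fun k => circleIntegral_outer hν hν0 hα hx hy,
    ← Finset.mul_sum]
  · field_simp
    ring
  · intro k hk
    refine mellinConvergent_tricomiWeight ν hy ?_
    have hk' : (k : ℝ) ≤ ⌊ν.re⌋₊ := Nat.cast_le.2 (Nat.lt_succ_iff.1 hk)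
    simp only [add_re, sub_re, natCast_re]
    linarith

end

/-! ### The Meijer G-function of the closed form -/

section

variable {ν x y : ℝ} {α : ℕ}

theorem egbInnerLeft_t6Block (s : ℂ) :
    egbInnerLeft (t6Block₁ ν α) t6Block₃ s = leftPoles [α - s - ν, 0] := by
  simp only [egbInnerLeft, t6Block₁, t6Block₃, List.map_cons, List.map_nil, List.cons_append,
    List.nil_append, neg_zero, neg_sub, sub_right_comm]

theorem egbInnerRight_t6Block (s : ℂ) :
    egbInnerRight (t6Block₁ ν α) t6Block₃ s = rightPoles [α - s] := by
  simp [egbInnerRight, t6Block₁, t6Block₃]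

theorem egbOuterLeft_t6Block :
    egbOuterLeft (t6Block₁ ν α) (t6Block₂ ν) t6Block₃ = leftPoles [0] := by
  simp [egbOuterLeft, t6Block₁, t6Block₂, t6Block₃]

theorem egbOuterRight_t6Block :
    egbOuterRight (t6Block₁ ν α) (t6Block₂ ν) t6Block₃ = rightPoles [-(ν : ℂ), α] := by
  simp [egbOuterRight, t6Block₁, t6Block₂, t6Block₃]

theorem egbInnerIntegrand_t6Block (s : ℂ) :
    egbInnerIntegrand (t6Block₁ ν α) t6Block₃ y s = fun t => (y : ℂ) ^ (-t) *
      (Gamma t * (Gamma (α - s - t) * Gamma (ν - (α - s - t)))) := by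
  ext t
  simp only [egbInnerIntegrand, GammaBlock.kernel, t6Block₁, t6Block₃, List.map_cons, List.map_nil,
    List.prod_cons, List.prod_nil, mul_one, div_one, zero_add, sub_sub_cancel]
  rw [← sub_sub, show (ν : ℂ) - (α - s - t) = ν - α + (s + t) by ring]
  ring

theorem egbOuterIntegrand_t6Block (hν : 0 < ν) (hy : 0 < y) {s : ℂ} (hs : s.re < α) :
    egbOuterIntegrand (t6Block₁ ν α) (t6Block₂ ν) t6Block₃ x y s = (x : ℂ) ^ (-s) *
      (Gamma s * Gamma (-ν - s) * mellin (tricomiWeight ν y) (α - s)) * Gamma ν := by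
  rw [egbOuterIntegrand, egbInnerLeft_t6Block, egbInnerRight_t6Block, egbInnerIntegrand_t6Block,
    mellinBarnes_inner (by simpa using hν) (by simpa using hs) hy]
  simp only [GammaBlock.kernel, t6Block₂, List.map_cons, List.map_nil, List.prod_cons,
    List.prod_nil, mul_one, div_one, zero_add, sub_add_cancel_left]
  ring

theorem eqOn_egbOuterIntegrand_t6Block (hν : 0 < ν) (hα : 1 ≤ α) (hy : 0 < y) :
    EqOn (egbOuterIntegrand (t6Block₁ ν α) (t6Block₂ ν) t6Block₃ x y)
      (fun s => (x : ℂ) ^ (-s) *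
        (Gamma s * Gamma (-ν - s) * mellin (tricomiWeight ν y) (α - s)) * Gamma ν)
      (mellinBarnesContour (leftPoles [0]) (rightPoles [-(ν : ℂ), α])) := fun s hs =>
  egbOuterIntegrand_t6Block hν hy <| by
    simpa using re_lt_of_mem_mellinBarnesContour_outer (by simpa using hν.le)
      (by simpa using hα) hs

theorem egbMeijerGConverges_t6Block (hν : 0 < ν) (hνint : ∀ k : ℕ, ν ≠ k) (hα : 1 ≤ α)
    (hx : 0 < x) (hy : 0 < y) :
    EGBMeijerGConverges (t6Block₁ ν α) (t6Block₂ ν) t6Block₃ x y := by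
  have hνint' : ∀ k : ℕ, (ν : ℂ) ≠ k := mod_cast hνint
  have hνre : 0 < (ν : ℂ).re := by simpa using hν
  have hαre : 1 ≤ (α : ℂ).re := by simpa using hα
  rw [EGBMeijerGConverges, egbOuterLeft_t6Block, egbOuterRight_t6Block]
  refine ⟨((mellinBarnesConverges_outer hνint' hνre.le hαre hx hy).mul_const (Gamma ν)).congr
    (eqOn_egbOuterIntegrand_t6Block hν hα hy).symm, fun s hs => ?_⟩
  rw [egbInnerLeft_t6Block, egbInnerRight_t6Block, egbInnerIntegrand_t6Block]
  refine mellinBarnesConverges_inner hνre ?_ hy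
  simpa using re_lt_of_mem_mellinBarnesContour_outer hνre.le hαre hs

theorem one_add_mul_cpow_mul_tricomiWeight_ofReal (hx : 0 < x) {u : ℝ} (hu : 0 < u) :
    (1 + x * u : ℂ) ^ (ν : ℂ) * tricomiWeight ν y u =
      (Real.exp (-(y * u)) * ((1 + u) / (1 + x * u)) ^ (-ν) : ℝ) := by
  have hxu : 0 ≤ 1 + x * u := by positivity
  rw [tricomiWeight, Real.div_rpow (by positivity) hxu, Real.rpow_neg hxu, div_inv_eq_mul]
  push_cast [ofReal_cpow hxu, ofReal_cpow (by positivity : 0 ≤ 1 + u)]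
  ring

theorem egbMeijerG_t6Block (hν : 0 < ν) (hνint : ∀ k : ℕ, ν ≠ k) (hα : 1 ≤ α)
    (hx : 0 < x) (hy : 0 < y) :
    egbMeijerG (t6Block₁ ν α) (t6Block₂ ν) t6Block₃ x y =
      (Real.Gamma ν * Real.Gamma (-ν) * ∫ u in Ioi (0 : ℝ), u ^ ((α : ℝ) - 1) *
        (Real.exp (-(y * u)) * ((1 + u) / (1 + x * u)) ^ (-ν)) : ℝ) := by
  rw [egbMeijerG, egbOuterLeft_t6Block, egbOuterRight_t6Block,
    mellinBarnes_congr (eqOn_egbOuterIntegrand_t6Block hν hα hy), mellinBarnes_mul_const,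
    mellinBarnes_outer (mod_cast hνint) (by simpa using hν.le) (by simpa using hα) hx hy, mellin]
  push_cast [← integral_complex_ofReal, ← Gamma_ofReal]
  rw [mul_comm, ← mul_assoc]
  congr 1
  refine setIntegral_congr_fun measurableSet_Ioi fun u (hu : 0 < u) => ?_
  rw [one_add_mul_cpow_mul_tricomiWeight_ofReal hx hu, smul_eq_mul, ofReal_cpow hu.le]
  push_cast
  rfl

end

/-! ### Gamma laws of the channel gains -/

section

variable {a r : ℝ}

theorem measurable_gammaPDF (a r : ℝ) : Measurable (gammaPDF a r) :=
  (measurable_gammaPDFReal a r).ennreal_ofReal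

theorem integral_gammaMeasure {E : Type*} [NormedAddCommGroup E] [NormedSpace ℝ E] (ha : 0 < a)
    (hr : 0 < r) (f : ℝ → E) :
    ∫ x, f x ∂gammaMeasure a r =
      ∫ x in Ioi 0, (r ^ a / Real.Gamma a * x ^ (a - 1) * Real.exp (-(r * x))) • f x := by
  rw [gammaMeasure, integral_withDensity_eq_integral_toReal_smul
    (measurable_gammaPDF a r) (ae_of_all _ fun _ => ENNReal.ofReal_lt_top),
    ← integral_Ici_eq_integral_Ioi, ← integral_indicator measurableSet_Ici]
  congr 1 with x
  rw [gammaPDF, ENNReal.toReal_ofReal (gammaPDFReal_nonneg ha hr x)]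
  by_cases hx : x ∈ Ici 0
  · rw [indicator_of_mem hx, gammaPDFReal, if_pos (mem_Ici.1 hx)]
  · rw [indicator_of_notMem hx, gammaPDFReal, if_neg (mt mem_Ici.2 hx), zero_smul]

theorem ae_pos_gammaMeasure (a r : ℝ) : ∀ᵐ x ∂gammaMeasure a r, 0 < x := by
  refine (ae_withDensity_iff (measurable_gammaPDF a r)).2 ?_
  filter_upwards [Measure.ae_ne volume 0] with x hx0 hx
  exact (not_lt.1 fun h => hx (gammaPDF_of_neg h)).lt_of_ne' hx0

theorem gammaMeasure_real_Ici (a r x : ℝ) :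
    (gammaMeasure a r).real (Ici x) = (gammaMeasure a r).real (Ioi x) :=
  measureReal_congr ((withDensity_absolutelyContinuous _ _).ae_eq Ioi_ae_eq_Ici.symm)

theorem mgf_gammaMeasure (ha : 0 < a) (hr : 0 < r) (t : ℝ) :
    mgf id (gammaMeasure a r) t = if t < r then (r / (r - t)) ^ a else 0 := by
  have hdensity (x : ℝ) :
      (r ^ a / Real.Gamma a * x ^ (a - 1) * Real.exp (-(r * x))) • Real.exp (t * x) =
        r ^ a / Real.Gamma a * (x ^ (a - 1) * Real.exp (-((r - t) * x))) := by
    rw [smul_eq_mul, mul_assoc, ← Real.exp_add, mul_assoc]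
    ring_nf
  simp only [mgf, id, integral_gammaMeasure ha hr, hdensity, integral_const_mul]
  split_ifs with ht
  · have hrt := sub_pos.2 ht
    rw [Real.integral_rpow_mul_exp_neg_mul_Ioi ha hrt, Real.div_rpow hr.le hrt.le,
      Real.div_rpow zero_le_one hrt.le, Real.one_rpow]
    field_simp
  · refine mul_eq_zero_of_right _ (integral_undef fun hintg => not_integrableOn_Ioi_rpow (a - 1) ?_)
    refine Integrable.mono' hintg (Measurable.aestronglyMeasurable (by fun_prop)) ?_
    filter_upwards [ae_restrict_mem measurableSet_Ioi] with x (hx : 0 < x)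
    rw [Real.norm_of_nonneg (by positivity)]
    exact le_mul_of_one_le_right (by positivity) (Real.one_le_exp (by nlinarith))

theorem zero_mem_interior_integrableExpSet_gammaMeasure (ha : 0 < a) (hr : 0 < r) :
    0 ∈ interior (integrableExpSet id (gammaMeasure a r)) := by
  refine interior_maximal (fun t (ht : t < r) => ?_) isOpen_Iio hr
  by_contra hundef
  have hpos : 0 < (r / (r - t)) ^ a := Real.rpow_pos_of_pos (div_pos hr (sub_pos.2 ht)) _
  have hzero := mgf_gammaMeasure ha hr t
  rw [mgf_undef hundef, if_pos ht] at hzero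
  exact hpos.ne hzero

end

theorem measure_eq_of_mgf_eq {ρ₁ ρ₂ : Measure ℝ} [IsProbabilityMeasure ρ₁] [IsFiniteMeasure ρ₂]
    (h : mgf id ρ₁ = mgf id ρ₂) (h0 : 0 ∈ interior (integrableExpSet id ρ₁)) : ρ₁ = ρ₂ := by
  refine Measure.ext_of_charFun (funext fun t => ?_)
  rw [← complexMGF_id_mul_I, ← complexMGF_id_mul_I]
  exact eqOn_complexMGF_of_mgf h (by simpa using h0)

theorem integral_exp_mul_sq_gaussianReal (c : ℝ) :
    ∫ x, Real.exp (c * x ^ 2) ∂gaussianReal 0 (1 / 2) = (√π)⁻¹ * √(π / (1 - c)) := by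
  rw [integral_gaussianReal_eq_integral_smul (by norm_num), ← integral_gaussian,
    ← integral_const_mul]
  congr 1 with x
  rw [gaussianPDFReal, smul_eq_mul, mul_assoc, ← Real.exp_add]
  congr 2 <;> push_cast <;> ring_nf

theorem measurable_complex_mk : Measurable fun p : ℝ × ℝ => (⟨p.1, p.2⟩ : ℂ) :=
  measurableEquivRealProd.symm.measurable

instance isProbabilityMeasure_stdComplexNormal : IsProbabilityMeasure stdComplexNormal :=
  Measure.isProbabilityMeasure_map measurable_complex_mk.aemeasurable

theorem mgf_norm_sq_stdComplexNormal (t : ℝ) :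
    mgf (fun z : ℂ => ‖z‖ ^ 2) stdComplexNormal t = if t < 1 then (1 - t)⁻¹ else 0 := by
  have hfactor (p : ℝ × ℝ) : Real.exp (t * ‖(⟨p.1, p.2⟩ : ℂ)‖ ^ 2) =
      Real.exp (t * p.1 ^ 2) * Real.exp (t * p.2 ^ 2) := by
    rw [← Real.exp_add, Complex.sq_norm, normSq_mk]
    ring_nf
  rw [mgf, stdComplexNormal, integral_map measurable_complex_mk.aemeasurable
    (Measurable.aestronglyMeasurable (by fun_prop))]
  simp only [hfactor]
  rw [integral_prod_mul (fun x => Real.exp (t * x ^ 2)) (fun x => Real.exp (t * x ^ 2)),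
    integral_exp_mul_sq_gaussianReal, mul_mul_mul_comm, ← mul_inv,
    Real.mul_self_sqrt Real.pi_pos.le]
  split_ifs with ht
  · have ht' := sub_pos.2 ht
    rw [Real.mul_self_sqrt (by positivity)]
    field_simp
  · rw [Real.sqrt_eq_zero_of_nonpos
      (div_nonpos_of_nonneg_of_nonpos Real.pi_pos.le (by linarith)), mul_zero, mul_zero]

theorem mrcGain_nonneg {S : Type*} {N : ℕ} (Ω : ℝ) (h : Fin N → S → ℂ) (ω : S) :
    0 ≤ mrcGain Ω h ω :=
  Finset.sum_nonneg fun _ _ => by positivity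

theorem mrcGain_eq_mul_sum {S : Type*} {N : ℕ} {Ω : ℝ} (hΩ : 0 ≤ Ω) (h : Fin N → S → ℂ) :
    mrcGain Ω h = fun ω => Ω * (∑ i, fun ω => ‖h i ω‖ ^ 2) ω := by
  ext ω
  simp only [mrcGain, norm_mul, norm_real, Real.norm_eq_abs, mul_pow, sq_abs, Real.sq_sqrt hΩ,
    Finset.sum_apply, Finset.mul_sum]

theorem measurable_normSq_combining (N : ℕ) (Ω : ℝ) :
    Measurable fun z : Fin N → ℂ => ∑ i, ‖(√Ω : ℂ) * z i‖ ^ 2 := by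
  fun_prop

section

variable {S : Type*} [MeasurableSpace S] {μ : Measure S}

theorem mgf_mrcGain {N : ℕ} {Ω : ℝ} (hΩ : 0 ≤ Ω) {h : Fin N → S → ℂ}
    (hlaw : ∀ i, HasLaw (h i) stdComplexNormal μ) (hindep : iIndepFun h μ) (t : ℝ) :
    mgf (mrcGain Ω h) μ t = (if Ω * t < 1 then (1 - Ω * t)⁻¹ else 0) ^ N := by
  have hmeas : Measurable fun z : ℂ => ‖z‖ ^ 2 := by fun_prop
  have hmgf (i : Fin N) : mgf (fun ω => ‖h i ω‖ ^ 2) μ (Ω * t) =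
      if Ω * t < 1 then (1 - Ω * t)⁻¹ else 0 := by
    rw [← mgf_norm_sq_stdComplexNormal]
    exact (hlaw i).integral_comp
      (f := fun z => Real.exp (Ω * t * ‖z‖ ^ 2)) (Measurable.aestronglyMeasurable (by fun_prop))
  have hsq : iIndepFun (fun i ω => ‖h i ω‖ ^ 2) μ :=
    hindep.comp (fun _ z => ‖z‖ ^ 2) fun _ => hmeas
  rw [mrcGain_eq_mul_sum hΩ, mgf_const_mul,
    hsq.mgf_sum₀ fun i => hmeas.comp_aemeasurable (hlaw i).aemeasurable]
  simp only [hmgf, Finset.prod_const, Finset.card_univ, Fintype.card_fin]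

theorem hasLaw_mrcGain {N : ℕ} (hN : 1 ≤ N) {Ω : ℝ} (hΩ : 0 < Ω) {h : Fin N → S → ℂ}
    (hlaw : ∀ i, HasLaw (h i) stdComplexNormal μ) (hindep : iIndepFun h μ) :
    HasLaw (mrcGain Ω h) (gammaMeasure N (1 / Ω)) μ := by
  have hN0 : (0 : ℝ) < N := by exact_mod_cast hN
  have hrate : 0 < 1 / Ω := one_div_pos.2 hΩ
  have := isProbabilityMeasure_gammaMeasure hN0 hrate
  have := hindep.isProbabilityMeasure
  have hmeas : AEMeasurable (mrcGain Ω h) μ := (measurable_normSq_combining N Ω).comp_aemeasurable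
    (aemeasurable_pi_lambda _ fun i => (hlaw i).aemeasurable)
  refine ⟨hmeas, (measure_eq_of_mgf_eq (funext fun t => ?_)
    (zero_mem_interior_integrableExpSet_gammaMeasure hN0 hrate)).symm⟩
  rw [mgf_gammaMeasure hN0 hrate, mgf_id_map hmeas, mgf_mrcGain hΩ.le hlaw hindep]
  simp only [lt_div_iff₀' hΩ]
  split_ifs with ht
  · rw [Real.rpow_natCast]
    field_simp
  · rw [zero_pow (by lia)]

theorem indepFun_pi_of_iIndepFun_sumElim {ι κ E : Type*} [Finite ι] [Finite κ]
    [MeasurableSpace E] {X : ι → S → E} {Y : κ → S → E} (hX : ∀ i, AEMeasurable (X i) μ)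
    (hY : ∀ j, AEMeasurable (Y j) μ) (h : iIndepFun (Sum.elim X Y) μ) :
    IndepFun (fun ω i => X i ω) (fun ω j => Y j ω) μ := by
  cases nonempty_fintype ι
  cases nonempty_fintype κ
  have hpi := h.indepFun_finset₀ (Finset.univ.map .inl) (Finset.univ.map .inr)
    (Finset.disjoint_map_inl_map_inr _ _) (by rintro (i | j); exacts [hX i, hY j])
  have hinl : Measurable fun (z : (Finset.univ.map .inl : Finset (ι ⊕ κ)) → E) (i : ι) =>
      z ⟨Sum.inl i, by simp⟩ := by fun_prop
  have hinr : Measurable fun (z : (Finset.univ.map .inr : Finset (ι ⊕ κ)) → E) (j : κ) =>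
      z ⟨Sum.inr j, by simp⟩ := by fun_prop
  exact hpi.comp hinl hinr

theorem indepFun_mrcGain {Nn Nf : ℕ} (Ωn Ωf : ℝ) {hn : Fin Nn → S → ℂ} {hf : Fin Nf → S → ℂ}
    (hmn : ∀ i, AEMeasurable (hn i) μ) (hmf : ∀ i, AEMeasurable (hf i) μ)
    (hindep : iIndepFun (Sum.elim hn hf) μ) :
    IndepFun (mrcGain Ωn hn) (mrcGain Ωf hf) μ :=
  (indepFun_pi_of_iIndepFun_sumElim hmn hmf hindep).comp
    (measurable_normSq_combining Nn Ωn) (measurable_normSq_combining Nf Ωf)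

end

/-! ### The minimum of two independent gains -/

theorem hasDerivAt_exp_neg_mul_sum_range (n : ℕ) (x : ℝ) :
    HasDerivAt (fun x => Real.exp (-x) * ∑ τ ∈ Finset.range (n + 1), x ^ τ / τ.factorial)
      (-(Real.exp (-x) * (x ^ n / n.factorial))) x := by
  have hexp : HasDerivAt (fun x => Real.exp (-x)) (-Real.exp (-x)) x := by
    simpa using (hasDerivAt_neg x).exp
  induction n with
  | zero => simpa using hexp
  | succ n ih =>
    simp only [Finset.sum_range_succ _ (n + 1), mul_add]
    refine (ih.add (hexp.mul ((hasDerivAt_pow (n + 1) x).div_const _))).congr_deriv ?_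
    rw [Nat.factorial_succ, add_tsub_cancel_right]
    push_cast
    field_simp
    ring

theorem tendsto_exp_neg_mul_sum_range (n : ℕ) :
    Tendsto (fun x => Real.exp (-x) * ∑ τ ∈ Finset.range n, x ^ τ / τ.factorial) atTop (𝓝 0) := by
  simp only [Finset.mul_sum]
  rw [← Finset.sum_const_zero (ι := ℕ) (s := Finset.range n)]
  refine tendsto_finsetSum _ fun τ _ => ?_
  have hτ := (Real.tendsto_pow_mul_exp_neg_atTop_nhds_zero τ).div_const (τ.factorial : ℝ)
  rw [zero_div] at hτ
  exact hτ.congr fun x => by ring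

theorem integral_Ioi_exp_neg_mul_pow_div_factorial (n : ℕ) {a : ℝ} (ha : 0 ≤ a) :
    ∫ x in Ioi a, Real.exp (-x) * (x ^ n / n.factorial) =
      Real.exp (-a) * ∑ τ ∈ Finset.range (n + 1), a ^ τ / τ.factorial := by
  have hpos : ∀ x ∈ Ioi a, 0 ≤ Real.exp (-x) * (x ^ n / n.factorial) := fun x hx => by
    have := ha.trans (mem_Ioi.1 hx).le
    positivity
  have hFTC := integral_Ioi_of_hasDerivAt_of_nonpos'
    (fun x _ => hasDerivAt_exp_neg_mul_sum_range n x)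
    (fun x hx => neg_nonpos.2 (hpos x hx)) (tendsto_exp_neg_mul_sum_range (n + 1))
  rw [integral_neg, zero_sub] at hFTC
  exact neg_injective hFTC

theorem gammaMeasure_natCast_real_Ioi {N : ℕ} (hN : 1 ≤ N) {r a : ℝ} (hr : 0 < r) (ha : 0 ≤ a) :
    (gammaMeasure N r).real (Ioi a) =
      Real.exp (-(r * a)) * ∑ τ ∈ Finset.range N, (r * a) ^ τ / τ.factorial := by
  obtain ⟨n, rfl⟩ := Nat.exists_eq_add_of_le' hN
  have hdensity (x : ℝ) :
      r ^ ((n + 1 : ℕ) : ℝ) / Real.Gamma (n + 1 : ℕ) * x ^ (((n + 1 : ℕ) : ℝ) - 1) *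
        Real.exp (-(r * x)) = r * (Real.exp (-(r * x)) * ((r * x) ^ n / n.factorial)) := by
    push_cast
    rw [Real.Gamma_nat_eq_factorial, add_sub_cancel_right, Real.rpow_natCast,
      ← Nat.cast_succ, Real.rpow_natCast, Nat.succ_eq_add_one]
    ring
  have hindicator (x : ℝ) (f : ℝ → ℝ) :
      f x • (Ioi a).indicator (1 : ℝ → ℝ) x = (Ioi a).indicator f x := by
    rw [smul_eq_mul, ← indicator_mul_right]
    simp only [Pi.one_apply, mul_one]
  simp only [← integral_indicator_one measurableSet_Ioi,
    integral_gammaMeasure (by positivity : (0 : ℝ) < (n + 1 : ℕ)) hr, hdensity]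
  simp only [hindicator _ fun x => r * (Real.exp (-(r * x)) * ((r * x) ^ n / n.factorial))]
  rw [setIntegral_indicator measurableSet_Ioi, Ioi_inter_Ioi, max_eq_right ha, integral_const_mul,
    integral_comp_mul_left_Ioi (fun x => Real.exp (-x) * (x ^ n / n.factorial)) a hr, smul_eq_mul,
    mul_inv_cancel_left₀ hr.ne', integral_Ioi_exp_neg_mul_pow_div_factorial n (by positivity)]

theorem integral_comp_min_prod {α E : Type*} [LinearOrder α] [TopologicalSpace α]
    [OrderClosedTopology α] [SecondCountableTopology α] [MeasurableSpace α]
    [OpensMeasurableSpace α] [NormedAddCommGroup E] [NormedSpace ℝ E] [CompleteSpace E]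
    {ρ₁ ρ₂ : Measure α} [IsFiniteMeasure ρ₁] [IsFiniteMeasure ρ₂] {φ : α → E}
    (h₁ : Integrable φ ρ₁) (h₂ : Integrable φ ρ₂) :
    ∫ p : α × α, φ (min p.1 p.2) ∂ρ₁.prod ρ₂ =
      ∫ x, ρ₂.real (Ioi x) • φ x ∂ρ₁ + ∫ x, ρ₁.real (Ici x) • φ x ∂ρ₂ := by
  have hlt : MeasurableSet {p : α × α | p.1 < p.2} := measurableSet_lt measurable_fst measurable_snd
  have hsplit (p : α × α) : φ (min p.1 p.2) =
      {p : α × α | p.1 < p.2}.indicator (fun p => φ p.1) p +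
        {p : α × α | p.1 < p.2}ᶜ.indicator (fun p => φ p.2) p := by
    rcases lt_or_ge p.1 p.2 with h | h
    · simp [h, h.le]
    · simp [h, h.not_gt]
  have hfst := (h₁.comp_fst ρ₂).indicator hlt
  have hsnd := (h₂.comp_snd ρ₁).indicator hlt.compl
  simp only [hsplit]
  rw [integral_add hfst hsnd, integral_prod _ hfst, integral_prod_symm _ hsnd]
  congr 2 with x
  · exact integral_indicator_const (φ x) measurableSet_Ioi
  · rw [← integral_indicator_const (φ x) measurableSet_Ici]
    congr 1 with y
    simp [indicator, not_lt]

theorem integral_gammaMeasure_real_Ioi_mul {a r s : ℝ} {M : ℕ} (ha : 0 < a) (hr : 0 < r)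
    (hM : 1 ≤ M) (hs : 0 < s) {φ : ℝ → ℝ} (hφ : Integrable φ (gammaMeasure a r)) :
    ∫ x, (gammaMeasure M s).real (Ioi x) * φ x ∂gammaMeasure a r =
      ∑ τ ∈ Finset.range M, r ^ a / Real.Gamma a * (s ^ τ / τ.factorial) *
        ∫ x in Ioi 0, x ^ (a + τ - 1) * Real.exp (-((r + s) * x)) * φ x := by
  have hpoisson_int (τ : ℕ) : Integrable
      (fun x => Real.exp (-(s * x)) * ((s * x) ^ τ / τ.factorial) * φ x) (gammaMeasure a r) := by
    refine hφ.bdd_mul (c := 1) (Measurable.aestronglyMeasurable (by fun_prop)) ?_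
    filter_upwards [ae_pos_gammaMeasure a r] with x hx
    rw [Real.norm_of_nonneg (by positivity), Real.exp_neg, inv_mul_le_one₀ (Real.exp_pos _)]
    exact Real.pow_div_factorial_le_exp _ (by positivity) τ
  have htail : ∫ x, (gammaMeasure M s).real (Ioi x) * φ x ∂gammaMeasure a r =
      ∫ x, ∑ τ ∈ Finset.range M,
        Real.exp (-(s * x)) * ((s * x) ^ τ / τ.factorial) * φ x ∂gammaMeasure a r := by
    refine integral_congr_ae ?_
    filter_upwards [ae_pos_gammaMeasure a r] with x hx
    rw [gammaMeasure_natCast_real_Ioi hM hs hx.le, Finset.mul_sum, Finset.sum_mul]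
  rw [htail, integral_finsetSum _ fun τ _ => hpoisson_int τ]
  refine Finset.sum_congr rfl fun τ _ => ?_
  rw [integral_gammaMeasure ha hr, ← integral_const_mul]
  refine setIntegral_congr_fun measurableSet_Ioi fun x (hx : 0 < x) => ?_
  have hpow : x ^ (a + τ - 1) = x ^ (a - 1) * x ^ τ := by
    rw [← Real.rpow_natCast x τ, ← Real.rpow_add hx]
    ring_nf
  have hexp : Real.exp (-((r + s) * x)) = Real.exp (-(r * x)) * Real.exp (-(s * x)) := by
    rw [← Real.exp_add]
    ring_nf
  simp only [hpow, hexp, mul_pow, smul_eq_mul]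
  ring

/-! ### The effective rate of the weak user -/

theorem integral_Ioi_rpow_sub_one_smul_comp_mul_left {E : Type*} [NormedAddCommGroup E]
    [NormedSpace ℝ E] (α : ℝ) {b : ℝ} (hb : 0 < b) (F : ℝ → E) :
    ∫ g in Ioi 0, g ^ (α - 1) • F (b * g) = b ^ (-α) • ∫ u in Ioi 0, u ^ (α - 1) • F u := by
  have hrescale := integral_comp_mul_left_Ioi (fun u : ℝ => u ^ (α - 1) • F u) 0 hb
  have hexponent : b ^ (-α) = (b ^ (α - 1))⁻¹ * b⁻¹ := by
    rw [← Real.rpow_neg hb.le, ← Real.rpow_neg_one b, ← Real.rpow_add hb]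
    ring_nf
  rw [mul_zero] at hrescale
  rw [hexponent, mul_smul, ← hrescale, ← integral_smul]
  refine setIntegral_congr_fun measurableSet_Ioi fun g (hg : 0 < g) => ?_
  rw [Real.mul_rpow hb.le hg.le, mul_smul, inv_smul_smul₀ (Real.rpow_pos_of_pos hb _).ne']

section

variable {S : Type*} [MeasurableSpace S] {μ : Measure S} {ν : ℝ} {γ : S → ℝ}

theorem integrable_one_add_rpow_neg [IsFiniteMeasure μ] (hν : 0 ≤ ν) (hγ : AEMeasurable γ μ)
    (hγ0 : ∀ᵐ ω ∂μ, 0 ≤ γ ω) : Integrable (fun ω => (1 + γ ω) ^ (-ν)) μ := by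
  refine Integrable.of_bound (AEMeasurable.aestronglyMeasurable (by fun_prop)) 1 ?_
  filter_upwards [hγ0] with ω hω
  rw [Real.norm_of_nonneg (by positivity)]
  exact Real.rpow_le_one_of_one_le_of_nonpos (by linarith) (neg_nonpos.2 hν)

theorem integral_one_add_rpow_neg_pos [IsFiniteMeasure μ] [NeZero μ] (hν : 0 ≤ ν)
    (hγ : AEMeasurable γ μ) (hγ0 : ∀ᵐ ω ∂μ, 0 ≤ γ ω) : 0 < ∫ ω, (1 + γ ω) ^ (-ν) ∂μ := by
  have hpos : ∀ᵐ ω ∂μ, 0 < (1 + γ ω) ^ (-ν) := by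
    filter_upwards [hγ0] with ω hω
    positivity
  have hsupport : Function.support (fun ω => (1 + γ ω) ^ (-ν)) =ᵐ[μ] univ :=
    eventuallyEq_univ.2 (hpos.mono fun _ => ne_of_gt)
  rw [integral_pos_iff_support_of_nonneg_ae (hpos.mono fun _ => le_of_lt)
    (integrable_one_add_rpow_neg hν hγ hγ0), measure_congr hsupport]
  exact Measure.measure_univ_pos.2 (NeZero.ne μ)

end

section

variable {aₛ a_w P : ℝ}

theorem measurable_sinrWeakSymbol (aₛ a_w P : ℝ) : Measurable (sinrWeakSymbol aₛ a_w P) := by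
  unfold sinrWeakSymbol
  fun_prop

theorem sinrWeakSymbol_nonneg (haₛ : 0 ≤ aₛ) (haw : 0 ≤ a_w) (hP : 0 ≤ P) {g : ℝ} (hg : 0 ≤ g) :
    0 ≤ sinrWeakSymbol aₛ a_w P g := by
  unfold sinrWeakSymbol
  positivity

theorem sinrWeakSymbol_monotoneOn (haₛ : 0 ≤ aₛ) (haw : 0 ≤ a_w) (hP : 0 ≤ P) :
    MonotoneOn (sinrWeakSymbol aₛ a_w P) (Ici 0) := by
  intro g (hg : 0 ≤ g) h (hh : 0 ≤ h) hgh
  unfold sinrWeakSymbol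
  rw [div_le_div_iff₀ (by positivity) (by positivity)]
  have : a_w * P * g ≤ a_w * P * h := by gcongr
  linarith

theorem sinrWeakStatistical_eq_sinrWeakInstantaneous {S : Type*} (haₛ : 0 ≤ aₛ) (haw : 0 ≤ a_w)
    (hP : 0 ≤ P) {gn gf : S → ℝ} (hgn : ∀ ω, 0 ≤ gn ω) (hgf : ∀ ω, 0 ≤ gf ω) :
    sinrWeakStatistical aₛ a_w P gn gf = sinrWeakInstantaneous aₛ a_w P gn gf :=
  funext fun ω => ((sinrWeakSymbol_monotoneOn haₛ haw hP).map_min (hgn ω) (hgf ω)).symm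

theorem one_add_sinrWeakSymbol {K : ℕ} (hK : 0 < K) (hsum : aₛ + a_w = 2 / K) (haₛ : 0 ≤ aₛ)
    (hP : 0 ≤ P) {g : ℝ} (hg : 0 ≤ g) :
    1 + sinrWeakSymbol aₛ a_w P g =
      (1 + 2 * P / K * g) / (1 + K / 2 * aₛ * (2 * P / K * g)) := by
  have hinterference : K / 2 * aₛ * (2 * P / K * g) = aₛ * P * g := by
    have : (K : ℝ) ≠ 0 := by positivity
    field_simp
  have htotal : 2 * P / K * g = aₛ * P * g + a_w * P * g := by
    rw [← add_mul, ← add_mul, hsum]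
    ring
  have hden : 1 + aₛ * P * g ≠ 0 := by positivity
  rw [hinterference, htotal, sinrWeakSymbol, ← add_assoc, add_div, div_self hden]

variable {ν Ωh : ℝ} {K : ℕ}

theorem integral_Ioi_rpow_mul_exp_mul_one_add_sinrWeakSymbol (hK : 0 < K)
    (hsum : aₛ + a_w = 2 / K) (haₛ : 0 ≤ aₛ) (hP : 0 < P) (α : ℝ) :
    ∫ x in Ioi 0, x ^ (α - 1) * Real.exp (-(1 / Ωh * x)) * (1 + sinrWeakSymbol aₛ a_w P x) ^ (-ν) =
      (2 * P / K) ^ (-α) * ∫ u in Ioi 0, u ^ (α - 1) *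
        (Real.exp (-(K / (2 * Ωh * P) * u)) * ((1 + u) / (1 + K / 2 * aₛ * u)) ^ (-ν)) := by
  have hrate (x : ℝ) : K / (2 * Ωh * P) * (2 * P / K * x) = 1 / Ωh * x := by
    field_simp
  rw [← smul_eq_mul ((2 * P / K) ^ (-α))]
  refine Eq.trans (setIntegral_congr_fun measurableSet_Ioi fun x (hx : 0 < x) => ?_)
    (integral_Ioi_rpow_sub_one_smul_comp_mul_left α (by positivity : 0 < 2 * P / K) _)
  rw [hrate, one_add_sinrWeakSymbol hK hsum haₛ hP.le hx.le, smul_eq_mul, mul_assoc]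

theorem T6_eq_integral (hν : 0 < ν) (hνint : ∀ k : ℕ, ν ≠ k) (hK : 0 < K) (haₛ : 0 < aₛ)
    (haw : 0 ≤ a_w) (hsum : aₛ + a_w = 2 / K) (hP : 0 < P) {α₁ α₂ : ℕ} (hα₁ : 1 ≤ α₁)
    (hα₂ : 1 ≤ α₂) {β₁ β₂ : ℝ} (hβ₁ : 0 < β₁) (hβ₂ : 0 < β₂) (hΩh : 1 / Ωh = 1 / β₁ + 1 / β₂) :
    T6 ν P aₛ Ωh K α₁ α₂ β₁ β₂ =
      (∫ x, (gammaMeasure α₂ (1 / β₂)).real (Ioi x) * (1 + sinrWeakSymbol aₛ a_w P x) ^ (-ν)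
        ∂gammaMeasure α₁ (1 / β₁) : ℝ) := by
  have hα₁' : (0 : ℝ) < α₁ := by exact_mod_cast hα₁
  have hΩ : 0 < Ωh := one_div_pos.1 (hΩh ▸ by positivity)
  have hΓ : Real.Gamma ν ≠ 0 := (Real.Gamma_pos_of_pos hν).ne'
  have hΓneg : Real.Gamma (-ν) ≠ 0 := Real.Gamma_ne_zero fun m hm => hνint m (neg_injective hm)
  have := isProbabilityMeasure_gammaMeasure hα₁' (one_div_pos.2 hβ₁)
  have hintg : Integrable (fun x => (1 + sinrWeakSymbol aₛ a_w P x) ^ (-ν))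
      (gammaMeasure α₁ (1 / β₁)) :=
    integrable_one_add_rpow_neg hν.le (measurable_sinrWeakSymbol aₛ a_w P).aemeasurable
      ((ae_pos_gammaMeasure _ _).mono fun x hx => sinrWeakSymbol_nonneg haₛ.le haw hP.le hx.le)
  rw [integral_gammaMeasure_real_Ioi_mul hα₁' (one_div_pos.2 hβ₁) hα₂ (one_div_pos.2 hβ₂) hintg,
    T6, ofReal_sum]
  refine Finset.sum_congr rfl fun τ _ => ?_
  have hexponent : (α₁ : ℝ) + τ = ((α₁ + τ : ℕ) : ℝ) := (Nat.cast_add α₁ τ).symm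
  rw [← hΩh, hexponent, integral_Ioi_rpow_mul_exp_mul_one_add_sinrWeakSymbol hK hsum haₛ.le hP,
    egbMeijerG_t6Block hν hνint (le_add_right hα₁) (by positivity) (by positivity), ← ofReal_mul,
    Real.rpow_natCast, one_div_pow, one_div_pow]
  congr 1
  generalize (∫ u in Ioi (0 : ℝ), _ : ℝ) = J
  field_simp

theorem T6_add_T6_eq_integral {S : Type*} [MeasurableSpace S] {μ : Measure S} [IsFiniteMeasure μ]
    (hν : 0 < ν) (hνint : ∀ k : ℕ, ν ≠ k) (hK : 0 < K) (haₛ : 0 < aₛ) (haw : 0 ≤ a_w)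
    (hsum : aₛ + a_w = 2 / K) (hP : 0 < P) {Nn Nf : ℕ} (hNn : 1 ≤ Nn) (hNf : 1 ≤ Nf)
    {Ωn Ωf : ℝ} (hΩn : 0 < Ωn) (hΩf : 0 < Ωf) (hΩh : Ωh = Ωn * Ωf / (Ωn + Ωf)) {gn gf : S → ℝ}
    (hgn : HasLaw gn (gammaMeasure Nn (1 / Ωn)) μ) (hgf : HasLaw gf (gammaMeasure Nf (1 / Ωf)) μ)
    (hind : IndepFun gn gf μ) :
    T6 ν P aₛ Ωh K Nn Nf Ωn Ωf + T6 ν P aₛ Ωh K Nf Nn Ωf Ωn =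
      (∫ ω, (1 + sinrWeakInstantaneous aₛ a_w P gn gf ω) ^ (-ν) ∂μ : ℝ) := by
  have hparallel : 1 / Ωh = 1 / Ωn + 1 / Ωf := by
    rw [hΩh]
    field_simp
    ring
  have := isProbabilityMeasure_gammaMeasure (Nat.cast_pos.2 hNn) (one_div_pos.2 hΩn)
  have := isProbabilityMeasure_gammaMeasure (Nat.cast_pos.2 hNf) (one_div_pos.2 hΩf)
  have hmeas := measurable_sinrWeakSymbol aₛ a_w P
  have hintg (a r : ℝ) [IsFiniteMeasure (gammaMeasure a r)] :
      Integrable (fun x => (1 + sinrWeakSymbol aₛ a_w P x) ^ (-ν)) (gammaMeasure a r) :=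
    integrable_one_add_rpow_neg hν.le hmeas.aemeasurable
      ((ae_pos_gammaMeasure a r).mono fun x hx => sinrWeakSymbol_nonneg haₛ.le haw hP.le hx.le)
  have hmin := (hind.hasLaw_prod hgn hgf).integral_comp
    (f := fun p => (1 + sinrWeakSymbol aₛ a_w P (min p.1 p.2)) ^ (-ν))
    (Measurable.aestronglyMeasurable (by fun_prop))
  rw [T6_eq_integral hν hνint hK haₛ haw hsum hP hNn hNf hΩn hΩf hparallel,
    T6_eq_integral hν hνint hK haₛ haw hsum hP hNf hNn hΩf hΩn
      (hparallel.trans (add_comm _ _)), ← ofReal_add]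
  congr 1
  refine Eq.trans ?_ hmin.symm
  rw [integral_comp_min_prod (hintg _ _) (hintg _ _)]
  simp only [gammaMeasure_real_Ici, smul_eq_mul]

end

theorem mainTheorem5_general {S : Type*} [MeasurableSpace S] (μ : Measure S)
    [IsProbabilityMeasure μ] (K : ℕ) (hK : 0 < K) (Nn Nf : ℕ) (hNn : 1 ≤ Nn) (hNf : 1 ≤ Nf)
    (Ωn Ωf : ℝ) (hΩn : 0 < Ωn) (hΩf : 0 < Ωf) (aₛ a_w : ℝ) (haₛ : 0 < aₛ) (haw : 0 ≤ a_w)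
    (hsum : aₛ + a_w = 2 / K) (P ν : ℝ) (hP : 0 < P) (hν : 0 < ν) (hνint : ∀ k : ℕ, ν ≠ k)
    (hhatn : Fin Nn → S → ℂ) (hhatf : Fin Nf → S → ℂ)
    (hlawn : ∀ i, HasLaw (hhatn i) stdComplexNormal μ)
    (hlawf : ∀ i, HasLaw (hhatf i) stdComplexNormal μ)
    (hindep : iIndepFun (Sum.elim hhatn hhatf) μ)
    (Ωh : ℝ) (hΩh : Ωh = Ωn * Ωf / (Ωn + Ωf)) :
    (∀ α ∈ Finset.Ico Nn (Nn + Nf) ∪ Finset.Ico Nf (Nf + Nn),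
      EGBMeijerGConverges (t6Block₁ ν α) (t6Block₂ ν) t6Block₃
        (K / 2 * aₛ) (K / (2 * Ωh * P))) ∧
    (T6 ν P aₛ Ωh K Nn Nf Ωn Ωf + T6 ν P aₛ Ωh K Nf Nn Ωf Ωn).im = 0 ∧
    0 < (T6 ν P aₛ Ωh K Nn Nf Ωn Ωf + T6 ν P aₛ Ωh K Nf Nn Ωf Ωn).re ∧
    effectiveRate μ ν
        (sinrWeakInstantaneous aₛ a_w P (mrcGain Ωn hhatn) (mrcGain Ωf hhatf)) =
      -(1 / ν) * Real.logb 2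
        (T6 ν P aₛ Ωh K Nn Nf Ωn Ωf + T6 ν P aₛ Ωh K Nf Nn Ωf Ωn).re ∧
    effectiveRate μ ν
        (sinrWeakStatistical aₛ a_w P (mrcGain Ωn hhatn) (mrcGain Ωf hhatf)) =
      -(1 / ν) * Real.logb 2
        (T6 ν P aₛ Ωh K Nn Nf Ωn Ωf + T6 ν P aₛ Ωh K Nf Nn Ωf Ωn).re := by
  have hΩpos : 0 < Ωh := hΩh ▸ by positivity
  have hlaw_gn := hasLaw_mrcGain hNn hΩn hlawn (hindep.precomp (g := Sum.inl) Sum.inl_injective)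
  have hlaw_gf := hasLaw_mrcGain hNf hΩf hlawf (hindep.precomp (g := Sum.inr) Sum.inr_injective)
  have hgains_indep := indepFun_mrcGain Ωn Ωf (fun i => (hlawn i).aemeasurable)
    (fun i => (hlawf i).aemeasurable) hindep
  have hT6 := T6_add_T6_eq_integral hν hνint hK haₛ haw hsum hP hNn hNf hΩn hΩf hΩh
    hlaw_gn hlaw_gf hgains_indep
  have hγ_meas : AEMeasurable
      (sinrWeakInstantaneous aₛ a_w P (mrcGain Ωn hhatn) (mrcGain Ωf hhatf)) μ :=
    (measurable_sinrWeakSymbol aₛ a_w P).comp_aemeasurable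
      (hlaw_gn.aemeasurable.min hlaw_gf.aemeasurable)
  have hγ_nonneg (ω : S) :
      0 ≤ sinrWeakInstantaneous aₛ a_w P (mrcGain Ωn hhatn) (mrcGain Ωf hhatf) ω :=
    sinrWeakSymbol_nonneg haₛ.le haw hP.le (le_min (mrcGain_nonneg ..) (mrcGain_nonneg ..))
  rw [sinrWeakStatistical_eq_sinrWeakInstantaneous haₛ.le haw hP.le (mrcGain_nonneg Ωn hhatn)
    (mrcGain_nonneg Ωf hhatf), hT6, ofReal_re, ofReal_im]
  refine ⟨fun α hα => egbMeijerGConverges_t6Block hν hνint ?_ (by positivity) (by positivity), rfl,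
    integral_one_add_rpow_neg_pos hν.le hγ_meas (ae_of_all _ hγ_nonneg), rfl, rfl⟩
  simp only [Finset.mem_union, Finset.mem_Ico] at hα
  omega

end

theorem mainTheorem5 {S : Type*} [MeasurableSpace S] (μ : Measure S) [IsProbabilityMeasure μ]
    -- system parameters
    (K : ℕ) (hK : 0 < K) (hKeven : Even K)
    (Nn Nf : ℕ) (hNn : 1 ≤ Nn) (hNf : 1 ≤ Nf)
    (Ωn Ωf Ωp : ℝ) (hΩn : 0 < Ωn) (hΩf : 0 < Ωf) (hΩp : 0 < Ωp)
    (aₛ a_w : ℝ) (haₛ : 0 < aₛ) (haw : aₛ < a_w) (hsum : aₛ + a_w = 2 / K)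
    (I δ N₀ B T θ : ℝ) (hI : 0 < I) (hδ₀ : 0 < δ) (hδ₁ : δ < 1) (hN₀ : 0 < N₀)
    (hB : 0 < B) (hT : 0 < T) (hθ : 0 < θ)
    -- bandwidth of a user pair, transmit power, normalized transmit power, exponent
    (Bpair Pt P ν : ℝ) (hBpair : Bpair = 2 * B / K)
    (hPt : Pt = -I / (Ωp * Real.log δ)) (hP : P = Pt / (N₀ * Bpair))
    (hν : ν = θ * T * Bpair / Real.log 2)
    (hνint : ∀ k : ℕ, ν ≠ k)
    -- independent Rayleigh fading
    (hhatn : Fin Nn → S → ℂ) (hhatf : Fin Nf → S → ℂ)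
    (hlawn : ∀ i, HasLaw (hhatn i) stdComplexNormal μ)
    (hlawf : ∀ i, HasLaw (hhatf i) stdComplexNormal μ)
    (hindep : iIndepFun (Sum.elim hhatn hhatf) μ)
    (Ωh : ℝ) (hΩh : Ωh = Ωn * Ωf / (Ωn + Ωf)) :
    -- the bivariate Meijer G-functions are well defined
    (∀ α ∈ Finset.Ico Nn (Nn + Nf) ∪ Finset.Ico Nf (Nf + Nn),
      EGBMeijerGConverges (t6Block₁ ν α) (t6Block₂ ν) t6Block₃
        (K / 2 * aₛ) (K / (2 * Ωh * P))) ∧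
    -- the argument of the logarithm is a positive real number
    (T6 ν P aₛ Ωh K Nn Nf Ωn Ωf + T6 ν P aₛ Ωh K Nf Nn Ωf Ωn).im = 0 ∧
    0 < (T6 ν P aₛ Ωh K Nn Nf Ωn Ωf + T6 ν P aₛ Ωh K Nf Nn Ωf Ωn).re ∧
    -- instantaneous secondary-link CSI
    effectiveRate μ ν
        (sinrWeakInstantaneous aₛ a_w P (mrcGain Ωn hhatn) (mrcGain Ωf hhatf)) =
      -(1 / ν) * Real.logb 2
        (T6 ν P aₛ Ωh K Nn Nf Ωn Ωf + T6 ν P aₛ Ωh K Nf Nn Ωf Ωn).re ∧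
    -- statistical secondary-link CSI
    effectiveRate μ ν
        (sinrWeakStatistical aₛ a_w P (mrcGain Ωn hhatn) (mrcGain Ωf hhatf)) =
      -(1 / ν) * Real.logb 2
        (T6 ν P aₛ Ωh K Nn Nf Ωn Ωf + T6 ν P aₛ Ωh K Nf Nn Ωf Ωn).re := by
  have hBpair_pos : 0 < Bpair := hBpair ▸ by positivity
  have hPt_pos : 0 < Pt := hPt ▸ div_pos_of_neg_of_neg (neg_lt_zero.2 hI)
    (mul_neg_of_pos_of_neg hΩp (Real.log_neg hδ₀ hδ₁))
  exact mainTheorem5_general μ K hK Nn Nf hNn hNf Ωn Ωf hΩn hΩf aₛ a_w haₛ (haₛ.trans haw).le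
    hsum P ν (hP ▸ by positivity) (hν ▸ by positivity) hνint hhatn hhatf hlawn hlawf hindep Ωh hΩh
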